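/- Let $k$ be a field of characteristic $0$, let $A$ be an abelian group, and let $\epsilon: A\times A\to k^*$ be an antisymmetric bicharacter, i.e. $\epsilon(a,bc)=\epsilon(a,b)\epsilon(a,c)$, $\epsilon(ab,c)=\epsilon(a,c)\epsilon(b,c)$ and $\epsilon(b,a)=\epsilon(a,b)^{-1}$ for all $a,b,c\in A$. Write $|x|$ for the degree of an $A$-homogeneous element $x$. Let $G$ be a finite abelian group acting linearly on a finite-dimensional $k$-vector space $V$ (written ${}^g v$), and let $L=V\otimes_k kG$ with the $kG$-bimodule structure $g(v\otimes h)g'={}^gv\otimes ghg'$. Suppose that $kG$ is an $A$-graded algebra in which every $g\in G$ is homogeneous, that $V$ is an $A$-graded vector space, and that $L$ is an $A$-graded $kG$-bimodule. Suppose that $[\ ,\ ]:L\times L\to L$ makes $L$ an $(A,\epsilon)$-color Lie ring over $kG$: it is $k$-bilinear, satisfies $[rx,y]=r[x,y]$, $[x,yr]=[x,y]r$ and $[xr,y]=[x,ry]$ for $r\in kG$ and $x,y\in L$, and, for all $A$-homogeneous $x,y,z\in L$, - $[x,y]$ is homogeneous of degree $|x||y|$, - $[x,y]=-\epsilon(|x|,|y|)\,[y,x]$,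 - $\epsilon(|z|,|x|)[x,[y,z]]+\epsilon(|x|,|y|)[y,[z,x]]+\epsilon(|y|,|z|)[z,[x,y]]=0$. Suppose moreover that $L$ is Yetter–Drinfeld, i.e. $|v\otimes g|=|v||g|$ and ${}^gv=\epsilon(|g|,|v|)\,v$ for all $g\in G$ and all homogeneous $v\in V$; that $\epsilon(|g|,|h|)=1$ for all $g,h\in G$; and that $L$ has purely positive part, i.e. $L=V_+\otimes kG$, where $V_+$ is the span of the homogeneous $v\in V$ with $\epsilon(|v|,|v|)=1$. Let $\mathcal U(L)=T_{kG}(L)/J$ be the universal enveloping algebra, where $T_{kG}(L)$ is the tensor algebra of the $kG$-bimodule $L$ and $J$ is the two-sided ideal generated by all $x\otimes y-\epsilon(|x|,|y|)\,y\otimes x-[x,y]$ with $x,y\in L$ homogeneous. Then $\mathcal U(L)$ has the PBW property: for every basis $v_1,\dots,v_n$ of $V$ consisting of $A$-homogeneous vectors, the elements $$v_1^{m_1}v_2^{m_2}\cdots v_n^{m_n}\,g\qquad (m_1,\dots,m_n\in\mathbb N,\ g\in G),$$ where $v_i$ stands for the image of $v_i\otimes 1_G$, are pairwise distinct and form a $k$-basis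 of $\mathcal U(L)$. -/

import Mathlib

open scoped TensorProduct

noncomputable section

namespace ColorLie

universe uk uA uR uL uG uV

/-! ### Gradings and bicharacters -/

/-- The subspaces `𝓜 a` decompose `M` as an (internal) direct sum of vector spaces. -/
def IsGrading {k : Type uk} {A : Type uA} {M : Type uL} [Field k] [AddCommGroup M] [Module k M]
    (𝓜 : A → Submodule k M) : Prop :=
  iSupIndep 𝓜 ∧ ⨆ a, 𝓜 a = ⊤

/-- `R = ⨁ a, 𝓡 a` is an `A`-graded `k`-algebra (the abelian group `A` is written
multiplicatively). -/
structure IsGradedAlgebra {k : Type uk} {A : Type uA} {R : Type uR} [Field k] [CommGroup A]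
    [Ring R] [Algebra k R] (𝓡 : A → Submodule k R) : Prop where
  isGrading : IsGrading 𝓡
  mul_mem : ∀ {a b : A} {r s : R}, r ∈ 𝓡 a → s ∈ 𝓡 b → r * s ∈ 𝓡 (a * b)

/-- `L = ⨁ a, 𝓛 a` is an `A`-graded bimodule over the graded algebra `R`. The right action
`x · r` is the action of `MulOpposite.op r`. -/
structure IsGradedBimodule {k : Type uk} {A : Type uA} {R : Type uR} {L : Type uL} [Field k]
    [CommGroup A] [Ring R] [Algebra k R] [AddCommGroup L] [Module k L] [Module R L]
    [Module Rᵐᵒᵖ L] [IsScalarTower k R L] [IsScalarTower k Rᵐᵒᵖ L] [SMulCommClass R Rᵐᵒᵖ L]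
    (𝓡 : A → Submodule k R) (𝓛 : A → Submodule k L) : Prop where
  isGrading : IsGrading 𝓛
  smul_mem : ∀ {a b c : A} {r s : R} {x : L}, r ∈ 𝓡 a → x ∈ 𝓛 b → s ∈ 𝓡 c →
    MulOpposite.op s • (r • x) ∈ 𝓛 (a * b * c)

/-- An antisymmetric bicharacter `ε : A × A → kˣ`. -/
structure IsAntisymmBicharacter {k : Type uk} {A : Type uA} [Field k] [CommGroup A]
    (ε : A → A → kˣ) : Prop where
  mul_right : ∀ a b c : A, ε a (b * c) = ε a b * ε a c
  mul_left : ∀ a b c : A, ε (a * b) c = ε a c * ε b c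
  antisymm : ∀ a b : A, ε b a = (ε a b)⁻¹

/-! ### Color Lie rings -/

/-- `L`, with the bracket `br`, is an `(A, ε)`-color Lie ring over the `A`-graded algebra `R`.
Homogeneity is expressed by membership in the graded pieces; the identities are trivial when one
of the arguments is zero, so the choice of a degree for `0` is immaterial. -/
structure IsColorLieRing {k : Type uk} {A : Type uA} {R : Type uR} {L : Type uL} [Field k]
    [CommGroup A] [Ring R] [Algebra k R] [AddCommGroup L] [Module k L] [Module R L]
    [Module Rᵐᵒᵖ L] [IsScalarTower k R L] [IsScalarTower k Rᵐᵒᵖ L] [SMulCommClass R Rᵐᵒᵖ L]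
    (ε : A → A → kˣ) (𝓡 : A → Submodule k R) (𝓛 : A → Submodule k L)
    (br : L →ₗ[k] L →ₗ[k] L) : Prop where
  bicharacter : IsAntisymmBicharacter ε
  gradedAlgebra : IsGradedAlgebra 𝓡
  gradedBimodule : IsGradedBimodule 𝓡 𝓛
  left_linear : ∀ (r : R) (x y : L), br (r • x) y = r • br x y
  right_linear : ∀ (r : R) (x y : L),
    br x (MulOpposite.op r • y) = MulOpposite.op r • br x y
  balanced : ∀ (r : R) (x y : L), br (MulOpposite.op r • x) y = br x (r • y)
  graded : ∀ {a b : A} {x y : L}, x ∈ 𝓛 a → y ∈ 𝓛 b → br x y ∈ 𝓛 (a * b)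
  antisymm : ∀ {a b : A} {x y : L}, x ∈ 𝓛 a → y ∈ 𝓛 b →
    br x y = -((ε a b : k) • br y x)
  jacobi : ∀ {a b c : A} {x y z : L}, x ∈ 𝓛 a → y ∈ 𝓛 b → z ∈ 𝓛 c →
    (ε c a : k) • br x (br y z) + (ε a b : k) • br y (br z x)
      + (ε b c : k) • br z (br x y) = 0

/-! ### The tensor algebra of a bimodule -/

/-- The relations which make `R → T` a homomorphism of `k`-algebras and `L → T` a homomorphism of
`R`-bimodules, where `T` is generated by the vector space `R × L`. -/
inductive TensorRingRel (k : Type uk) (R : Type uR) (L : Type uL) [Field k] [Ring R] [Algebra k R]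
    [AddCommGroup L] [Module k L] [Module R L] [Module Rᵐᵒᵖ L] :
    TensorAlgebra k (R × L) → TensorAlgebra k (R × L) → Prop
  | one : TensorRingRel k R L (TensorAlgebra.ι k ((1 : R), (0 : L))) 1
  | mul (r s : R) : TensorRingRel k R L
      (TensorAlgebra.ι k (r, (0 : L)) * TensorAlgebra.ι k (s, (0 : L)))
      (TensorAlgebra.ι k (r * s, (0 : L)))
  | left (r : R) (x : L) : TensorRingRel k R L
      (TensorAlgebra.ι k (r, (0 : L)) * TensorAlgebra.ι k ((0 : R), x))
      (TensorAlgebra.ι k ((0 : R), r • x))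
  | right (r : R) (x : L) : TensorRingRel k R L
      (TensorAlgebra.ι k ((0 : R), x) * TensorAlgebra.ι k (r, (0 : L)))
      (TensorAlgebra.ι k ((0 : R), MulOpposite.op r • x))

/-- The tensor algebra `T_R(L)` of the `R`-bimodule `L`, presented by generators and relations;
its universal property is `TensorRing.existsUnique_lift` below. -/
def TensorRing (k : Type uk) (R : Type uR) (L : Type uL) [Field k] [Ring R] [Algebra k R]
    [AddCommGroup L] [Module k L] [Module R L] [Module Rᵐᵒᵖ L] : Type _ :=
  RingQuot (TensorRingRel k R L)

namespace TensorRing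

instance (k : Type uk) (R : Type uR) (L : Type uL) [Field k] [Ring R] [Algebra k R]
    [AddCommGroup L] [Module k L] [Module R L] [Module Rᵐᵒᵖ L] : Ring (TensorRing k R L) :=
  inferInstanceAs (Ring (RingQuot (TensorRingRel k R L)))

instance (k : Type uk) (R : Type uR) (L : Type uL) [Field k] [Ring R] [Algebra k R]
    [AddCommGroup L] [Module k L] [Module R L] [Module Rᵐᵒᵖ L] : Algebra k (TensorRing k R L) :=
  inferInstanceAs (Algebra k (RingQuot (TensorRingRel k R L)))

/-- The quotient map from the free algebra on the vector space `R × L`. -/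
def mk (k : Type uk) (R : Type uR) (L : Type uL) [Field k] [Ring R] [Algebra k R]
    [AddCommGroup L] [Module k L] [Module R L] [Module Rᵐᵒᵖ L] :
    TensorAlgebra k (R × L) →ₐ[k] TensorRing k R L :=
  RingQuot.mkAlgHom k (TensorRingRel k R L)

/-- The structure map `R → T_R(L)`. -/
def ofRing (k : Type uk) (R : Type uR) (L : Type uL) [Field k] [Ring R] [Algebra k R]
    [AddCommGroup L] [Module k L] [Module R L] [Module Rᵐᵒᵖ L] : R →ₗ[k] TensorRing k R L :=
  (mk k R L).toLinearMap ∘ₗ TensorAlgebra.ι k ∘ₗ LinearMap.inl k R L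

/-- The map `L → T_R(L)` onto the tensors of degree one. -/
def ι (k : Type uk) (R : Type uR) (L : Type uL) [Field k] [Ring R] [Algebra k R]
    [AddCommGroup L] [Module k L] [Module R L] [Module Rᵐᵒᵖ L] : L →ₗ[k] TensorRing k R L :=
  (mk k R L).toLinearMap ∘ₗ TensorAlgebra.ι k ∘ₗ LinearMap.inr k R L

section

variable {k : Type uk} {R : Type uR} {L : Type uL} [Field k] [Ring R] [Algebra k R]
    [AddCommGroup L] [Module k L] [Module R L] [Module Rᵐᵒᵖ L]

theorem mk_rel {x y : TensorAlgebra k (R × L)} (h : TensorRingRel k R L x y) :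
    mk k R L x = mk k R L y :=
  RingQuot.mkAlgHom_rel k h

theorem ofRing_one : ofRing k R L 1 = 1 :=
  (mk_rel TensorRingRel.one).trans (map_one _)

theorem ofRing_mul (r s : R) : ofRing k R L (r * s) = ofRing k R L r * ofRing k R L s :=
  (mk_rel (TensorRingRel.mul r s)).symm.trans (map_mul _ _ _)

theorem ι_smul (r : R) (x : L) : ι k R L (r • x) = ofRing k R L r * ι k R L x :=
  (mk_rel (TensorRingRel.left r x)).symm.trans (map_mul _ _ _)

theorem ι_op_smul (r : R) (x : L) :
    ι k R L (MulOpposite.op r • x) = ι k R L x * ofRing k R L r :=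
  (mk_rel (TensorRingRel.right r x)).symm.trans (map_mul _ _ _)

/-- The universal property of `T_R(L)`. -/
theorem existsUnique_lift {B : Type*} [Ring B] [Algebra k B] (f : R →ₐ[k] B) (φ : L →ₗ[k] B)
    (hl : ∀ (r : R) (x : L), φ (r • x) = f r * φ x)
    (hr : ∀ (r : R) (x : L), φ (MulOpposite.op r • x) = φ x * f r) :
    ∃! F : TensorRing k R L →ₐ[k] B,
      (∀ r, F (ofRing k R L r) = f r) ∧ ∀ x, F (ι k R L x) = φ x := by
  have hrel : ∀ ⦃x y⦄, TensorRingRel k R L x y →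
      TensorAlgebra.lift k (f.toLinearMap.coprod φ) x =
        TensorAlgebra.lift k (f.toLinearMap.coprod φ) y := by
    intro x y h
    cases h <;> simp [hl, hr]
  let F : TensorRing k R L →ₐ[k] B :=
    RingQuot.liftAlgHom k ⟨TensorAlgebra.lift k (f.toLinearMap.coprod φ), hrel⟩
  have hF (x) : F (mk k R L x) = TensorAlgebra.lift k (f.toLinearMap.coprod φ) x :=
    RingQuot.liftAlgHom_mkAlgHom_apply k _ hrel x
  refine ⟨F, ⟨fun r => (hF _).trans (by simp), fun x => (hF _).trans (by simp)⟩, ?_⟩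
  rintro F' ⟨h1, h2⟩
  apply RingQuot.ringQuot_ext'
  apply TensorAlgebra.hom_ext
  apply LinearMap.prod_ext
  · ext r
    exact (h1 r).trans ((hF _).trans (by simp)).symm
  · ext x
    exact (h2 x).trans ((hF _).trans (by simp)).symm

end

end TensorRing

/-! ### The universal enveloping algebra -/

/-- The relations `u ⊗ v = ε(|u|, |v|) v ⊗ u + [u, v]`, for homogeneous `u` and `v`. -/
inductive EnvelopingRel {k : Type uk} {A : Type uA} {R : Type uR} {L : Type uL} [Field k]
    [Ring R] [Algebra k R] [AddCommGroup L] [Module k L] [Module R L] [Module Rᵐᵒᵖ L]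
    (ε : A → A → kˣ) (𝓛 : A → Submodule k L) (br : L →ₗ[k] L →ₗ[k] L) :
    TensorRing k R L → TensorRing k R L → Prop
  | bracket {a b : A} {u v : L} (hu : u ∈ 𝓛 a) (hv : v ∈ 𝓛 b) : EnvelopingRel ε 𝓛 br
      (TensorRing.ι k R L u * TensorRing.ι k R L v)
      ((ε a b : k) • (TensorRing.ι k R L v * TensorRing.ι k R L u) + TensorRing.ι k R L (br u v))

/-- The universal enveloping algebra `U(L) = T_R(L) / J`, where `J` is the two-sided ideal
generated by all `u ⊗ v - ε(|u|, |v|) v ⊗ u - [u, v]` with `u`, `v` homogeneous. -/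
def Enveloping {k : Type uk} {A : Type uA} (R : Type uR) {L : Type uL} [Field k]
    [Ring R] [Algebra k R] [AddCommGroup L] [Module k L] [Module R L] [Module Rᵐᵒᵖ L]
    (ε : A → A → kˣ) (𝓛 : A → Submodule k L) (br : L →ₗ[k] L →ₗ[k] L) : Type _ :=
  RingQuot (EnvelopingRel (R := R) ε 𝓛 br)

instance {k : Type uk} {A : Type uA} (R : Type uR) {L : Type uL} [Field k]
    [Ring R] [Algebra k R] [AddCommGroup L] [Module k L] [Module R L] [Module Rᵐᵒᵖ L]
    (ε : A → A → kˣ) (𝓛 : A → Submodule k L) (br : L →ₗ[k] L →ₗ[k] L) :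
    Ring (Enveloping R ε 𝓛 br) :=
  inferInstanceAs (Ring (RingQuot (EnvelopingRel (R := R) ε 𝓛 br)))

instance {k : Type uk} {A : Type uA} (R : Type uR) {L : Type uL} [Field k]
    [Ring R] [Algebra k R] [AddCommGroup L] [Module k L] [Module R L] [Module Rᵐᵒᵖ L]
    (ε : A → A → kˣ) (𝓛 : A → Submodule k L) (br : L →ₗ[k] L →ₗ[k] L) :
    Algebra k (Enveloping R ε 𝓛 br) :=
  inferInstanceAs (Algebra k (RingQuot (EnvelopingRel (R := R) ε 𝓛 br)))

/-- The quotient map `T_R(L) → U(L)`. -/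
def Enveloping.mk {k : Type uk} {A : Type uA} (R : Type uR) {L : Type uL} [Field k]
    [Ring R] [Algebra k R] [AddCommGroup L] [Module k L] [Module R L] [Module Rᵐᵒᵖ L]
    (ε : A → A → kˣ) (𝓛 : A → Submodule k L) (br : L →ₗ[k] L →ₗ[k] L) :
    TensorRing k R L →ₐ[k] Enveloping R ε 𝓛 br :=
  RingQuot.mkAlgHom k (EnvelopingRel (R := R) ε 𝓛 br)

/-- The map `R → U(L)`. -/
def Enveloping.ofRing {k : Type uk} {A : Type uA} (R : Type uR) {L : Type uL} [Field k]
    [Ring R] [Algebra k R] [AddCommGroup L] [Module k L] [Module R L] [Module Rᵐᵒᵖ L]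
    (ε : A → A → kˣ) (𝓛 : A → Submodule k L) (br : L →ₗ[k] L →ₗ[k] L) :
    R →ₗ[k] Enveloping R ε 𝓛 br :=
  (Enveloping.mk R ε 𝓛 br).toLinearMap ∘ₗ TensorRing.ofRing k R L

/-- The map `L → U(L)`. -/
def Enveloping.ι {k : Type uk} {A : Type uA} (R : Type uR) {L : Type uL} [Field k]
    [Ring R] [Algebra k R] [AddCommGroup L] [Module k L] [Module R L] [Module Rᵐᵒᵖ L]
    (ε : A → A → kˣ) (𝓛 : A → Submodule k L) (br : L →ₗ[k] L →ₗ[k] L) :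
    L →ₗ[k] Enveloping R ε 𝓛 br :=
  (Enveloping.mk R ε 𝓛 br).toLinearMap ∘ₗ TensorRing.ι k R L

/-! ### The bimodule `V ⊗ kG` -/

/-- The vector space `V ⊗ kG`, for a representation `ρ` of `G` on `V`; it carries the
`kG`-bimodule structure `g (v ⊗ h) g' = ρ g v ⊗ g h g'`. -/
def TensorGroupAlgebra {k : Type uk} {G : Type uG} {V : Type uV} [Field k] [Group G]
    [AddCommGroup V] [Module k V] (_ρ : Representation k G V) : Type _ :=
  V ⊗[k] MonoidAlgebra k G

namespace TensorGroupAlgebra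

variable {k : Type uk} {G : Type uG} {V : Type uV} [Field k] [Group G]
    [AddCommGroup V] [Module k V]

instance (ρ : Representation k G V) : AddCommGroup (TensorGroupAlgebra ρ) :=
  inferInstanceAs (AddCommGroup (V ⊗[k] MonoidAlgebra k G))

instance (ρ : Representation k G V) : Module k (TensorGroupAlgebra ρ) :=
  inferInstanceAs (Module k (V ⊗[k] MonoidAlgebra k G))

/-- The element `v ⊗ r`. -/
def tmul (ρ : Representation k G V) (v : V) (r : MonoidAlgebra k G) : TensorGroupAlgebra ρ :=
  (v ⊗ₜ[k] r : V ⊗[k] MonoidAlgebra k G)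

/-- The action of a group element from the left: `g (v ⊗ r) = ρ g v ⊗ g r`. -/
def leftRep (ρ : Representation k G V) : G →* Module.End k (V ⊗[k] MonoidAlgebra k G) where
  toFun g := TensorProduct.map (ρ g) (LinearMap.mulLeft k (MonoidAlgebra.of k G g))
  map_one' := by
    refine TensorProduct.ext' fun v r => ?_
    rw [TensorProduct.map_tmul, map_one, map_one, LinearMap.mulLeft_apply, one_mul]
    rfl
  map_mul' g h := by
    refine TensorProduct.ext' fun v r => ?_
    rw [Module.End.mul_apply, TensorProduct.map_tmul, TensorProduct.map_tmul,
      TensorProduct.map_tmul, map_mul, map_mul, LinearMap.mulLeft_apply, LinearMap.mulLeft_apply,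
      LinearMap.mulLeft_apply, mul_assoc]
    rfl

/-- The left action of `kG`. -/
def leftAct (ρ : Representation k G V) :
    MonoidAlgebra k G →ₐ[k] Module.End k (V ⊗[k] MonoidAlgebra k G) :=
  MonoidAlgebra.lift k _ G (leftRep ρ)

/-- The action of `s` from the right: `(v ⊗ r) s = v ⊗ r s`. -/
def rightAct (_ρ : Representation k G V) :
    (MonoidAlgebra k G)ᵐᵒᵖ →+* Module.End k (V ⊗[k] MonoidAlgebra k G) where
  toFun s := LinearMap.lTensor V (LinearMap.mulRight k s.unop)
  map_one' := by
    refine TensorProduct.ext' fun v r => ?_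
    rw [LinearMap.lTensor_tmul, LinearMap.mulRight_apply, MulOpposite.unop_one, mul_one]
    rfl
  map_mul' s t := by
    refine TensorProduct.ext' fun v r => ?_
    rw [Module.End.mul_apply, LinearMap.lTensor_tmul, LinearMap.lTensor_tmul,
      LinearMap.lTensor_tmul, LinearMap.mulRight_apply, LinearMap.mulRight_apply,
      LinearMap.mulRight_apply, MulOpposite.unop_mul, mul_assoc]
  map_zero' := by
    refine TensorProduct.ext' fun v r => ?_
    rw [LinearMap.lTensor_tmul, LinearMap.mulRight_apply, MulOpposite.unop_zero, mul_zero,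
      TensorProduct.tmul_zero]
    rfl
  map_add' s t := by
    refine TensorProduct.ext' fun v r => ?_
    rw [LinearMap.add_apply, LinearMap.lTensor_tmul, LinearMap.lTensor_tmul,
      LinearMap.lTensor_tmul, LinearMap.mulRight_apply, LinearMap.mulRight_apply,
      LinearMap.mulRight_apply, MulOpposite.unop_add, mul_add, TensorProduct.tmul_add]

instance (ρ : Representation k G V) : Module (MonoidAlgebra k G) (TensorGroupAlgebra ρ) :=
  Module.compHom (V ⊗[k] MonoidAlgebra k G) (leftAct ρ).toRingHom

instance (ρ : Representation k G V) : Module (MonoidAlgebra k G)ᵐᵒᵖ (TensorGroupAlgebra ρ) :=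
  Module.compHom (V ⊗[k] MonoidAlgebra k G) (rightAct ρ)

theorem of_smul_tmul (ρ : Representation k G V) (g : G) (v : V) (r : MonoidAlgebra k G) :
    MonoidAlgebra.of k G g • tmul ρ v r = tmul ρ (ρ g v) (MonoidAlgebra.of k G g * r) := by
  change leftAct ρ (MonoidAlgebra.of k G g) (v ⊗ₜ[k] r) = _
  rw [leftAct, MonoidAlgebra.lift_of]
  rfl

theorem op_smul_tmul (ρ : Representation k G V) (s : MonoidAlgebra k G) (v : V)
    (r : MonoidAlgebra k G) :
    MulOpposite.op s • tmul ρ v r = tmul ρ v (r * s) := rfl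

@[elab_as_elim]
theorem induction_on {ρ : Representation k G V} {motive : TensorGroupAlgebra ρ → Prop}
    (x : TensorGroupAlgebra ρ) (zero : motive 0) (tmul : ∀ v r, motive (tmul ρ v r))
    (add : ∀ x y, motive x → motive y → motive (x + y)) : motive x :=
  TensorProduct.induction_on (motive := motive) x zero tmul add

instance (ρ : Representation k G V) :
    IsScalarTower k (MonoidAlgebra k G) (TensorGroupAlgebra ρ) where
  smul_assoc c r x := by
    change leftAct ρ (c • r) x = c • leftAct ρ r x
    rw [map_smul]
    rfl

instance (ρ : Representation k G V) :
    IsScalarTower k (MonoidAlgebra k G)ᵐᵒᵖ (TensorGroupAlgebra ρ) where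
  smul_assoc c r x := by
    induction x using induction_on with
    | zero => rw [smul_zero, smul_zero, smul_zero]
    | add x y hx hy => rw [smul_add, smul_add, smul_add, hx, hy]
    | tmul v s =>
      change v ⊗ₜ[k] (s * (c • r).unop) = c • (v ⊗ₜ[k] (s * r.unop))
      rw [MulOpposite.unop_smul, mul_smul_comm, TensorProduct.tmul_smul]

instance (ρ : Representation k G V) :
    SMulCommClass (MonoidAlgebra k G) (MonoidAlgebra k G)ᵐᵒᵖ (TensorGroupAlgebra ρ) where
  smul_comm r s x := by
    induction x using induction_on with
    | zero => rw [smul_zero, smul_zero, smul_zero]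
    | add x y hx hy => rw [smul_add, smul_add, smul_add, smul_add, hx, hy]
    | tmul v t =>
      induction r using MonoidAlgebra.induction_on with
      | of g =>
        change MonoidAlgebra.of k G g • MulOpposite.op s.unop • tmul ρ v t =
          MulOpposite.op s.unop • MonoidAlgebra.of k G g • tmul ρ v t
        rw [op_smul_tmul, of_smul_tmul, of_smul_tmul, op_smul_tmul, mul_assoc]
      | add a b ha hb => rw [add_smul, add_smul, smul_add, ha, hb]
      | smul c a ha =>
        have h (y : TensorGroupAlgebra ρ) : s • c • y = c • s • y :=
          (((rightAct ρ s).map_smul c y : _) : rightAct ρ s (c • y) = c • rightAct ρ s y)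
        rw [smul_assoc, smul_assoc, ha, h]

end TensorGroupAlgebra

/-! ### Yetter-Drinfeld color Lie rings and the PBW property -/

/-- The bracket `br` makes `L = V ⊗ kG` a (graded) Yetter-Drinfeld `(A, ε)`-color Lie ring over
`kG`, where `𝓡`, `𝓥` and `𝓛` are the `A`-gradings of `kG`, `V` and `L`. -/
structure IsYetterDrinfeld {k : Type uk} {A : Type uA} {G : Type uG} {V : Type uV} [Field k]
    [CommGroup A] [Group G] [AddCommGroup V] [Module k V] (ρ : Representation k G V)
    (ε : A → A → kˣ) (𝓡 : A → Submodule k (MonoidAlgebra k G)) (𝓥 : A → Submodule k V)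
    (𝓛 : A → Submodule k (TensorGroupAlgebra ρ))
    (br : TensorGroupAlgebra ρ →ₗ[k] TensorGroupAlgebra ρ →ₗ[k] TensorGroupAlgebra ρ) : Prop where
  colorLieRing : IsColorLieRing ε 𝓡 𝓛 br
  /-- `G` is graded by `A`: every element of `G` is homogeneous. -/
  group_homogeneous : ∀ g : G, ∃ a : A, MonoidAlgebra.of k G g ∈ 𝓡 a
  grading_V : IsGrading 𝓥
  /-- `|v ⊗ g| = |v| |g|`. -/
  tmul_mem : ∀ {a b : A} {v : V} {g : G}, v ∈ 𝓥 a → MonoidAlgebra.of k G g ∈ 𝓡 b →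
    TensorGroupAlgebra.tmul ρ v (MonoidAlgebra.of k G g) ∈ 𝓛 (a * b)
  /-- `g` acts on a homogeneous `v` as the scalar `ε(|g|, |v|)`. -/
  action : ∀ {a b : A} {v : V} {g : G}, v ∈ 𝓥 a → MonoidAlgebra.of k G g ∈ 𝓡 b →
    ρ g v = (ε b a : k) • v

/-- The span `V₊` of the homogeneous `v` in `V` with `ε(|v|, |v|) = 1`. -/
def positivePart {k : Type uk} {A : Type uA} {V : Type uV} [Field k] [AddCommGroup V] [Module k V]
    (ε : A → A → kˣ) (𝓥 : A → Submodule k V) : Submodule k V :=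
  Submodule.span k {v | ∃ a : A, v ∈ 𝓥 a ∧ ε a a = 1}

/-- `L = L₊`, where `L₊ = V₊ ⊗ kG`. -/
def IsPurelyPositive {k : Type uk} {A : Type uA} {G : Type uG} {V : Type uV} [Field k]
    [Group G] [AddCommGroup V] [Module k V] (ρ : Representation k G V)
    (ε : A → A → kˣ) (𝓥 : A → Submodule k V) : Prop :=
  Submodule.span k {x : TensorGroupAlgebra ρ |
    ∃ v ∈ positivePart ε 𝓥, ∃ r : MonoidAlgebra k G, x = TensorGroupAlgebra.tmul ρ v r} = ⊤

/-- The element `v₁ ^ m₁ ⋯ vₙ ^ mₙ g` of `U(L)`, where `v i` stands for `v i ⊗ 1`. -/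
def pbwMonomial {k : Type uk} {A : Type uA} {G : Type uG} {V : Type uV} [Field k]
    [Group G] [AddCommGroup V] [Module k V] (ρ : Representation k G V)
    (ε : A → A → kˣ) (𝓛 : A → Submodule k (TensorGroupAlgebra ρ))
    (br : TensorGroupAlgebra ρ →ₗ[k] TensorGroupAlgebra ρ →ₗ[k] TensorGroupAlgebra ρ)
    {n : ℕ} (v : Fin n → V) (p : (Fin n → ℕ) × G) : Enveloping (MonoidAlgebra k G) ε 𝓛 br :=
  (List.ofFn fun i => Enveloping.ι (MonoidAlgebra k G) ε 𝓛 br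
      (TensorGroupAlgebra.tmul ρ (v i) 1) ^ p.1 i).prod *
    Enveloping.ofRing (MonoidAlgebra k G) ε 𝓛 br (MonoidAlgebra.of k G p.2)

/-- The PBW property of `U(L)` with respect to `v₁, …, vₙ`: the family of all monomials
`v₁ ^ m₁ ⋯ vₙ ^ mₙ g` is a basis of the vector space `U(L)`. -/
def HasPBWProperty {k : Type uk} {A : Type uA} {G : Type uG} {V : Type uV} [Field k]
    [Group G] [AddCommGroup V] [Module k V] (ρ : Representation k G V)
    (ε : A → A → kˣ) (𝓛 : A → Submodule k (TensorGroupAlgebra ρ))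
    (br : TensorGroupAlgebra ρ →ₗ[k] TensorGroupAlgebra ρ →ₗ[k] TensorGroupAlgebra ρ)
    {n : ℕ} (v : Fin n → V) : Prop :=
  LinearIndependent k (pbwMonomial ρ ε 𝓛 br v) ∧
    Submodule.span k (Set.range (pbwMonomial ρ ε 𝓛 br v)) = ⊤

end ColorLie

end

/-! The proof is the classical one for Lie algebras: the enveloping algebra is made to act on the
space where the PBW monomials are independent by construction, the free module `Poly` over `kG` on
commutative monomials. The module structure plays the role of right multiplication by `kG`. From the
left, `g` multiplies a monomial by `g` and by the product of the characters `χ i (g) = ε(|g|, |v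
i|)` of its variables. A variable `v i` acts on a monomial `m` by insertion if `i` is at most every
variable of `m`. If `m = v j * m'` with `j < i` least in `m`, its action is forced by the relation
`v i v j = ε v j v i + [v i, v j]`. This recursion terminates because the degree drops, or stays the
same while the index drops (`varOp`). The heart is that these operators satisfy all the relations of
the enveloping algebra. Compatibility with `G` holds because `ε` is trivial on `G`, so that `v i ⊗
g'` commutes with `g` as `v i` does (`leftMul_basisOp_mon`). The commutation relations follow by
induction on the degree from the Jacobi identity (`basisOp_basisOp_of_lt`). The case `i = j` needs
`[v i, v i] = 0`, which follows from pure positivity and characteristic `0` (`basisOp_basisOp`). The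
map `orderedProd`, which sends a monomial to the ordered product of its variables, intertwines this
action with left multiplication. Applying an element of the enveloping algebra to the empty monomial
inverts it (`orderedProd_bijective`), so it carries the evident basis of `Poly` to the PBW
monomials. -/

noncomputable section

namespace ColorLie

universe uk uA uR uL uG uV

/-! ### Recursive construction of the operators on polynomials -/

section Operators

variable {k : Type uk} {G : Type uG} {V : Type uV} [Field k] [CommGroup G]
  [AddCommGroup V] [Module k V] {n : ℕ}

/-- The free `kG`-module on the commutative monomials in `n` variables. -/
abbrev Poly (k : Type uk) (G : Type uG) [Field k] [CommGroup G] (n : ℕ) : Type _ :=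
  Multiset (Fin n) →₀ MonoidAlgebra k G

/-- The monomial `m`. -/
abbrev mon (k : Type uk) (G : Type uG) [Field k] [CommGroup G] {n : ℕ} (m : Multiset (Fin n)) :
    Poly k G n :=
  Finsupp.single m 1

theorem poly_hom_ext {k : Type uk} {G : Type uG} [Field k] [CommGroup G] {n : ℕ} {M : Type*}
    [AddCommGroup M] [Module (MonoidAlgebra k G) M] {f g : Poly k G n →ₗ[MonoidAlgebra k G] M}
    (h : ∀ m, f (mon k G m) = g (mon k G m)) : f = g := by
  ext m
  exact h m

/-- The polynomials of degree at most `s`. -/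
def polyLE (k : Type uk) (G : Type uG) [Field k] [CommGroup G] (n s : ℕ) :
    Submodule (MonoidAlgebra k G) (Poly k G n) :=
  Submodule.span (MonoidAlgebra k G) {x | ∃ m : Multiset (Fin n), m.card ≤ s ∧ x = mon k G m}

theorem mon_mem_polyLE {m : Multiset (Fin n)} {s : ℕ} (h : m.card ≤ s) :
    mon k G m ∈ polyLE k G n s :=
  Submodule.subset_span ⟨m, h, rfl⟩

theorem polyLE_mono {s t : ℕ} (h : s ≤ t) : polyLE k G n s ≤ polyLE k G n t := by
  apply Submodule.span_mono
  rintro _ ⟨m, hm, rfl⟩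
  exact ⟨m, hm.trans h, rfl⟩

theorem eq_on_polyLE {M : Type*} [AddCommGroup M] [Module (MonoidAlgebra k G) M] {s : ℕ}
    {f g : Poly k G n →ₗ[MonoidAlgebra k G] M}
    (h : ∀ m : Multiset (Fin n), m.card ≤ s → f (mon k G m) = g (mon k G m)) {x : Poly k G n}
    (hx : x ∈ polyLE k G n s) : f x = g x := by
  refine LinearMap.eqOn_span (R := MonoidAlgebra k G) ?_ hx
  rintro _ ⟨m, hm, rfl⟩
  exact h m hm

theorem map_polyLE_le {s t : ℕ} {f : Module.End (MonoidAlgebra k G) (Poly k G n)}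
    (h : ∀ m : Multiset (Fin n), m.card ≤ s → f (mon k G m) ∈ polyLE k G n t) {x : Poly k G n}
    (hx : x ∈ polyLE k G n s) : f x ∈ polyLE k G n t := by
  have : polyLE k G n s ≤ (polyLE k G n t).comap f := by
    apply Submodule.span_le.2
    rintro _ ⟨m, hm, rfl⟩
    exact h m hm
  exact this hx

/-- The character by which `G` acts on the monomial `m`. -/
def weight (χ : Fin n → G →* k) (m : Multiset (Fin n)) : G →* k := (m.map χ).prod

theorem weight_zero (χ : Fin n → G →* k) : weight χ 0 = 1 := by simp [weight]

theorem weight_cons (χ : Fin n → G →* k) (i : Fin n) (m : Multiset (Fin n)) :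
    weight χ (i ::ₘ m) = χ i * weight χ m := by simp [weight]

/-- The left action of `kG` on `Poly k G n`. -/
def leftMul (χ : Fin n → G →* k) :
    MonoidAlgebra k G →ₐ[k] Module.End (MonoidAlgebra k G) (Poly k G n) :=
  MonoidAlgebra.lift k _ G
    { toFun := fun g => Finsupp.linearCombination (MonoidAlgebra k G) fun m =>
        (weight χ m g • MonoidAlgebra.of k G g) • mon k G m
      map_one' := by
        apply poly_hom_ext
        intro m
        simp only [map_one, one_smul, Finsupp.linearCombination_single, Module.End.one_apply]
      map_mul' := fun g h => by
        apply poly_hom_ext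
        intro m
        simp only [Finsupp.linearCombination_single, Module.End.mul_apply, map_mul, map_smul,
          smul_smul]
        congr 1
        simp only [smul_mul_assoc, mul_smul_comm, smul_smul, one_mul]
        -- The operators are `kG`-linear, so the composite produces `h * g`; commutativity of `G`
        -- restores the order.
        rw [mul_comm (MonoidAlgebra.of k G g)] }

theorem leftMul_of_mon (χ : Fin n → G →* k) (g : G) (m : Multiset (Fin n)) :
    leftMul χ (MonoidAlgebra.of k G g) (mon k G m) =
      (weight χ m g • MonoidAlgebra.of k G g) • mon k G m := by
  rw [leftMul, MonoidAlgebra.lift_of]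
  simp

/-- The value of `s` is irrelevant: its existence shows that `kG` preserves the degree and that
identities between `kG`-linear operators at `m` persist after acting by `r`. -/
theorem exists_leftMul_mon (χ : Fin n → G →* k) (r : MonoidAlgebra k G) (m : Multiset (Fin n)) :
    ∃ s : MonoidAlgebra k G, leftMul χ r (mon k G m) = s • mon k G m := by
  induction r using MonoidAlgebra.induction_on with
  | of g => exact ⟨_, leftMul_of_mon χ g m⟩
  | add a b ha hb =>
    obtain ⟨s, hs⟩ := ha
    obtain ⟨t, ht⟩ := hb
    exact ⟨s + t, by rw [map_add, LinearMap.add_apply, hs, ht, add_smul]⟩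
  | smul c a ha =>
    obtain ⟨s, hs⟩ := ha
    exact ⟨c • s, by rw [map_smul, LinearMap.smul_apply, hs, smul_assoc]⟩

theorem leftMul_mem_polyLE (χ : Fin n → G →* k) (r : MonoidAlgebra k G) {s : ℕ} {x : Poly k G n}
    (hx : x ∈ polyLE k G n s) : leftMul χ r x ∈ polyLE k G n s := by
  refine map_polyLE_le (fun m hm => ?_) hx
  obtain ⟨t, ht⟩ := exists_leftMul_mon χ r m
  rw [ht]
  exact Submodule.smul_mem _ _ (mon_mem_polyLE hm)

variable {ρ : Representation k G V} (v : Module.Basis (Fin n) k V) (χ : Fin n → G →* k)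

/-- The action of `V ⊗ kG` determined by the operators `f i` by which the `v i` act. -/
def actOf (f : Fin n → Module.End (MonoidAlgebra k G) (Poly k G n)) :
    TensorGroupAlgebra ρ →ₗ[k] Module.End (MonoidAlgebra k G) (Poly k G n) :=
  TensorProduct.lift (v.constr k fun i => LinearMap.mulLeft k (f i) ∘ₗ (leftMul χ).toLinearMap)

theorem actOf_tmul (f : Fin n → Module.End (MonoidAlgebra k G) (Poly k G n)) (i : Fin n)
    (r : MonoidAlgebra k G) :
    actOf v χ f (TensorGroupAlgebra.tmul ρ (v i) r) = f i * leftMul χ r := by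
  refine (TensorProduct.lift.tmul _ _).trans ?_
  rw [Module.Basis.constr_basis]
  rfl

theorem tmul_induction {motive : TensorGroupAlgebra ρ → Prop} (v : Module.Basis (Fin n) k V)
    (x : TensorGroupAlgebra ρ)
    (tmul : ∀ i g, motive (TensorGroupAlgebra.tmul ρ (v i) (MonoidAlgebra.of k G g)))
    (add : ∀ x y, motive x → motive y → motive (x + y))
    (smul : ∀ (c : k) x, motive x → motive (c • x)) (zero : motive 0) : motive x := by
  induction x using TensorGroupAlgebra.induction_on with
  | zero => exact zero
  | add x y hx hy => exact add x y hx hy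
  | tmul w r =>
    induction r using MonoidAlgebra.induction_on with
    | add a b ha hb =>
      have : TensorGroupAlgebra.tmul ρ w (a + b) =
          TensorGroupAlgebra.tmul ρ w a + TensorGroupAlgebra.tmul ρ w b :=
        TensorProduct.tmul_add _ _ _
      rw [this]
      exact add _ _ ha hb
    | smul c a ha =>
      have : TensorGroupAlgebra.tmul ρ w (c • a) = c • TensorGroupAlgebra.tmul ρ w a :=
        TensorProduct.tmul_smul _ _ _
      rw [this]
      exact smul _ _ ha
    | of g =>
      refine Submodule.span_induction (p := fun w _ =>
        motive (TensorGroupAlgebra.tmul ρ w (MonoidAlgebra.of k G g))) ?_ ?_ ?_ ?_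
        (v.mem_span w)
      · rintro _ ⟨i, rfl⟩
        exact tmul i g
      · have : TensorGroupAlgebra.tmul ρ 0 (MonoidAlgebra.of k G g) = 0 :=
          TensorProduct.zero_tmul _ _
        rw [this]
        exact zero
      · intro x y _ _ hx hy
        have : TensorGroupAlgebra.tmul ρ (x + y) (MonoidAlgebra.of k G g) =
            TensorGroupAlgebra.tmul ρ x (MonoidAlgebra.of k G g) +
              TensorGroupAlgebra.tmul ρ y (MonoidAlgebra.of k G g) :=
          TensorProduct.add_tmul _ _ _
        rw [this]
        exact add _ _ hx hy
      · intro c x _ hx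
        have : TensorGroupAlgebra.tmul ρ (c • x) (MonoidAlgebra.of k G g) =
            c • TensorGroupAlgebra.tmul ρ x (MonoidAlgebra.of k G g) :=
          (TensorProduct.smul_tmul' _ _ _).symm
        rw [this]
        exact smul _ _ hx

theorem actOf_op_smul (f : Fin n → Module.End (MonoidAlgebra k G) (Poly k G n))
    (r : MonoidAlgebra k G) (x : TensorGroupAlgebra ρ) :
    actOf v χ f (MulOpposite.op r • x) = actOf v χ f x * leftMul χ r := by
  induction x using tmul_induction v with
  | tmul i g =>
    rw [TensorGroupAlgebra.op_smul_tmul, actOf_tmul, actOf_tmul, map_mul, mul_assoc]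
  | add a b ha hb => rw [smul_add, map_add, map_add, ha, hb, add_mul]
  | smul c a ha => rw [smul_comm, map_smul _ c, map_smul _ c, ha, smul_mul_assoc]
  | zero => rw [smul_zero, map_zero, zero_mul]

/-- Since `kG` preserves the degree filtration, agreement of the variables up to degree `s` passes
to all of `V ⊗ kG`. -/
theorem actOf_congr {f f' : Fin n → Module.End (MonoidAlgebra k G) (Poly k G n)} {s : ℕ}
    (h : ∀ i, ∀ m : Multiset (Fin n), m.card ≤ s → f i (mon k G m) = f' i (mon k G m))
    (u : TensorGroupAlgebra ρ) {x : Poly k G n} (hx : x ∈ polyLE k G n s) :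
    actOf v χ f u x = actOf v χ f' u x := by
  induction u using tmul_induction v with
  | tmul i g =>
    rw [actOf_tmul, actOf_tmul]
    exact eq_on_polyLE (h i) (leftMul_mem_polyLE χ _ hx)
  | add a b ha hb => rw [map_add, map_add, LinearMap.add_apply, LinearMap.add_apply, ha, hb]
  | smul c a ha => rw [map_smul, map_smul, LinearMap.smul_apply, LinearMap.smul_apply, ha]
  | zero => simp

theorem actOf_mem_polyLE {f : Fin n → Module.End (MonoidAlgebra k G) (Poly k G n)} {s t : ℕ}
    (h : ∀ i, ∀ m : Multiset (Fin n), m.card ≤ s → f i (mon k G m) ∈ polyLE k G n t)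
    (u : TensorGroupAlgebra ρ) {x : Poly k G n} (hx : x ∈ polyLE k G n s) :
    actOf v χ f u x ∈ polyLE k G n t := by
  induction u using tmul_induction v with
  | tmul i g =>
    rw [actOf_tmul]
    exact map_polyLE_le (h i) (leftMul_mem_polyLE χ _ hx)
  | add a b ha hb => rw [map_add]; exact add_mem ha hb
  | smul c a ha =>
    rw [map_smul, LinearMap.smul_apply, ← algebraMap_smul (MonoidAlgebra k G) c]
    exact Submodule.smul_mem _ _ ha
  | zero => simp

/-- A least variable and its complement are determined by the multiset, so the arbitrary choice made
in `varStep` is harmless. -/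
theorem eq_of_cons_eq {i j : Fin n} {m m' : Multiset (Fin n)} (h : i ::ₘ m = j ::ₘ m')
    (hi : ∀ b ∈ m, i ≤ b) (hj : ∀ b ∈ m', j ≤ b) : i = j ∧ m = m' := by
  have h1 : i ∈ j ::ₘ m' := h ▸ Multiset.mem_cons_self i m
  have h2 : j ∈ i ::ₘ m := h ▸ Multiset.mem_cons_self j m'
  have hij : i = j := by
    rcases Multiset.mem_cons.1 h1 with h1 | h1
    · exact h1
    rcases Multiset.mem_cons.1 h2 with h2 | h2
    · exact h2.symm
    exact le_antisymm (hi _ h2) (hj _ h1)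
  subst hij
  exact ⟨rfl, (Multiset.cons_inj_right i).1 h⟩

theorem forall_le_or_exists_cons (i : Fin n) (m : Multiset (Fin n)) :
    (∀ b ∈ m, i ≤ b) ∨ ∃ j m', m = j ::ₘ m' ∧ j < i ∧ ∀ b ∈ m', j ≤ b := by
  by_cases h : ∀ b ∈ m, i ≤ b
  · exact Or.inl h
  push Not at h
  obtain ⟨b, hb, hbi⟩ := h
  obtain ⟨j, hj, hmin⟩ := m.toFinset.exists_min_image id ⟨b, Multiset.mem_toFinset.2 hb⟩
  rw [Multiset.mem_toFinset] at hj
  simp only [Multiset.mem_toFinset, id] at hmin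
  exact Or.inr ⟨j, m.erase j, (Multiset.cons_erase hj).symm, (hmin b hb).trans_lt hbi,
    fun c hc => hmin c (Multiset.mem_of_mem_erase hc)⟩

/-- Induction along the recursion which defines the action of a variable on a monomial. -/
theorem cons_induction {Q : Fin n → Multiset (Fin n) → Prop}
    (le : ∀ i m, (∀ b ∈ m, i ≤ b) → Q i m)
    (lt : ∀ i j m, j < i → (∀ b ∈ m, j ≤ b) →
      (∀ l (m' : Multiset (Fin n)), m'.card ≤ m.card → Q l m') →
      (∀ m' : Multiset (Fin n), m'.card ≤ m.card + 1 → Q j m') → Q i (j ::ₘ m))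
    (i : Fin n) (m : Multiset (Fin n)) : Q i m := by
  have key : ∀ s : ℕ, ∀ i, ∀ m : Multiset (Fin n), m.card ≤ s → Q i m := by
    intro s
    induction s with
    | zero =>
      intro i m hm
      rw [Nat.le_zero, Multiset.card_eq_zero] at hm
      subst hm
      exact le i 0 (by simp)
    | succ s ih =>
      intro i
      induction i using WellFoundedLT.induction with
      | ind i ih' =>
        intro m hm
        rcases forall_le_or_exists_cons i m with h | ⟨j, m', rfl, hji, hm'⟩
        · exact le i m h
        · rw [Multiset.card_cons] at hm
          exact lt i j m' hji hm' (fun l m'' h => ih l m'' (by omega))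
            (fun m'' h => ih' j hji m'' (by omega))
  exact key _ i m le_rfl

variable (e : Fin n → Fin n → k) (β : Fin n → Fin n → TensorGroupAlgebra ρ)

open Classical in
/-- One step of the recursion which defines the action of the variables: the result is correct on
monomials of degree `s + 1` if `Q` is correct on polynomials of degree at most `s`. -/
def varStep (Q : Fin n → Module.End (MonoidAlgebra k G) (Poly k G n)) (i : Fin n) :
    Module.End (MonoidAlgebra k G) (Poly k G n) :=
  Finsupp.linearCombination (MonoidAlgebra k G) fun m =>
    if h : ∃ p : Fin n × Multiset (Fin n), m = p.1 ::ₘ p.2 ∧ p.1 < i ∧ ∀ b ∈ p.2, p.1 ≤ b then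
      -- The inner operator and the bracket act on a monomial of smaller degree, where `Q` suffices.
      -- The outer one meets the full degree again and must be the new operator, available because
      -- its index is smaller.
      e i h.choose.1 • varStep Q h.choose.1 (Q i (mon k G h.choose.2)) +
        actOf v χ Q (β i h.choose.1) (mon k G h.choose.2)
    else mon k G (i ::ₘ m)
  termination_by i
  decreasing_by exact h.choose_spec.2.1

variable (Q : Fin n → Module.End (MonoidAlgebra k G) (Poly k G n))

theorem varStep_of_le {i : Fin n} {m : Multiset (Fin n)} (h : ∀ b ∈ m, i ≤ b) :
    varStep v χ e β Q i (mon k G m) = mon k G (i ::ₘ m) := by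
  rw [varStep, Finsupp.linearCombination_single, one_smul, dif_neg]
  rintro ⟨p, rfl, h1, -⟩
  exact absurd (h p.1 (Multiset.mem_cons_self _ _)) (not_le.2 h1)

theorem varStep_cons {i j : Fin n} {m : Multiset (Fin n)} (hj : j < i) (h : ∀ b ∈ m, j ≤ b) :
    varStep v χ e β Q i (mon k G (j ::ₘ m)) =
      e i j • varStep v χ e β Q j (Q i (mon k G m)) + actOf v χ Q (β i j) (mon k G m) := by
  have H : ∃ p : Fin n × Multiset (Fin n), j ::ₘ m = p.1 ::ₘ p.2 ∧ p.1 < i ∧ ∀ b ∈ p.2, p.1 ≤ b :=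
    ⟨(j, m), rfl, hj, h⟩
  rw [varStep, Finsupp.linearCombination_single, one_smul, dif_pos H]
  obtain ⟨h1, h2⟩ := eq_of_cons_eq H.choose_spec.1 h H.choose_spec.2.2
  rw [← h1, ← h2]

theorem varStep_mem_polyLE
    (hQ : ∀ i m, Q i (mon k G m) ∈ polyLE k G n (m.card + 1)) (i : Fin n) (m : Multiset (Fin n)) :
    varStep v χ e β Q i (mon k G m) ∈ polyLE k G n (m.card + 1) := by
  induction i, m using cons_induction with
  | le i m h =>
    rw [varStep_of_le _ _ _ _ _ h]
    exact mon_mem_polyLE (by simp)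
  | lt i j m hj h ih1 ih2 =>
    rw [varStep_cons _ _ _ _ _ hj h, ← algebraMap_smul (MonoidAlgebra k G)]
    rw [Multiset.card_cons]
    refine add_mem (Submodule.smul_mem _ _ ?_) ?_
    · exact map_polyLE_le (fun m' hm' => polyLE_mono (by omega) (ih2 m' hm')) (hQ i m)
    · exact actOf_mem_polyLE v χ (fun l m' hm' => polyLE_mono (by omega) (hQ l m')) _
        (mon_mem_polyLE le_rfl)

/-- The approximations of the action of the variables. -/
def varApprox : ℕ → Fin n → Module.End (MonoidAlgebra k G) (Poly k G n)
  | 0 => fun i => Finsupp.linearCombination (MonoidAlgebra k G) fun m => mon k G (i ::ₘ m)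
  | s + 1 => varStep v χ e β (varApprox s)

theorem varApprox_mem_polyLE (s : ℕ) (i : Fin n) (m : Multiset (Fin n)) :
    varApprox v χ e β s i (mon k G m) ∈ polyLE k G n (m.card + 1) := by
  induction s generalizing i m with
  | zero =>
    rw [varApprox, Finsupp.linearCombination_single, one_smul]
    exact mon_mem_polyLE (by simp)
  | succ s ih => exact varStep_mem_polyLE v χ e β _ ih i m

/-- Stage `s` is final up to degree `s`: induction on the degree, and within a degree on the index,
following the recursion. -/
theorem varApprox_succ_eq (s : ℕ) (i : Fin n) (m : Multiset (Fin n)) (hm : m.card ≤ s) :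
    varApprox v χ e β (s + 1) i (mon k G m) = varApprox v χ e β s i (mon k G m) := by
  induction s generalizing i m with
  | zero =>
    rw [Nat.le_zero, Multiset.card_eq_zero] at hm
    subst hm
    have h : ∀ b ∈ (0 : Multiset (Fin n)), i ≤ b := fun b hb => absurd hb (Multiset.notMem_zero b)
    refine (varStep_of_le v χ e β _ h).trans ?_
    rw [varApprox, Finsupp.linearCombination_single, one_smul]
  | succ s ih =>
    induction i using WellFoundedLT.induction generalizing m with
    | ind i ih' =>
      rcases forall_le_or_exists_cons i m with h | ⟨j, m', rfl, hji, hm'⟩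
      · rw [varApprox, varStep_of_le _ _ _ _ _ h, varApprox, varStep_of_le _ _ _ _ _ h]
      · rw [Multiset.card_cons] at hm
        rw [varApprox, varStep_cons _ _ _ _ _ hji hm', ih i m' (by omega),
          actOf_congr v χ ih _ (mon_mem_polyLE (by omega))]
        conv_rhs => rw [varApprox, varStep_cons _ _ _ _ _ hji hm']
        congr 2
        exact eq_on_polyLE (s := s + 1) (fun m'' h => ih' j hji m'' h)
          (polyLE_mono (by omega) (varApprox_mem_polyLE v χ e β s i m'))

/-- The operator by which `v i` acts on polynomials. -/
def varOp (i : Fin n) : Module.End (MonoidAlgebra k G) (Poly k G n) :=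
  Finsupp.linearCombination (MonoidAlgebra k G) fun m => varApprox v χ e β m.card i (mon k G m)

theorem varOp_mon_eq {s : ℕ} (i : Fin n) {m : Multiset (Fin n)} (hm : m.card ≤ s) :
    varOp v χ e β i (mon k G m) = varApprox v χ e β s i (mon k G m) := by
  rw [varOp, Finsupp.linearCombination_single, one_smul]
  induction s, hm using Nat.le_induction with
  | base => rfl
  | succ s hs ih => rw [ih, varApprox_succ_eq v χ e β s i m hs]

theorem varOp_of_le {i : Fin n} {m : Multiset (Fin n)} (h : ∀ b ∈ m, i ≤ b) :
    varOp v χ e β i (mon k G m) = mon k G (i ::ₘ m) := by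
  rw [varOp_mon_eq v χ e β i (Nat.le_succ m.card), varApprox, varStep_of_le _ _ _ _ _ h]

theorem varOp_mem_polyLE (i : Fin n) (m : Multiset (Fin n)) :
    varOp v χ e β i (mon k G m) ∈ polyLE k G n (m.card + 1) := by
  rw [varOp_mon_eq v χ e β i le_rfl]
  exact varApprox_mem_polyLE v χ e β _ i m

/-- Unfold stage `m.card + 1`, the degree of `j ::ₘ m`. By stability, every approximation on the
right can be replaced by the limit operator in the degree where it is applied. -/
theorem varOp_cons {i j : Fin n} {m : Multiset (Fin n)} (hj : j < i) (h : ∀ b ∈ m, j ≤ b) :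
    varOp v χ e β i (mon k G (j ::ₘ m)) = e i j • varOp v χ e β j (varOp v χ e β i (mon k G m)) +
      actOf v χ (varOp v χ e β) (β i j) (mon k G m) := by
  rw [varOp_mon_eq v χ e β i (s := m.card + 1) (by simp), varApprox, varStep_cons _ _ _ _ _ hj h]
  congr 1
  · congr 1
    rw [← varOp_mon_eq v χ e β i (le_refl m.card)]
    exact eq_on_polyLE (s := m.card + 1) (fun m' hm' => (varOp_mon_eq v χ e β j hm').symm)
      (varOp_mem_polyLE v χ e β i m)
  · exact (actOf_congr v χ (fun l m' hm' => varOp_mon_eq v χ e β l hm') _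
      (mon_mem_polyLE le_rfl)).symm

/-- The leading term of `v i * m` is the monomial `i ::ₘ m`, up to a scalar. -/
theorem exists_varOp_sub_mem (i : Fin n) (m : Multiset (Fin n)) :
    ∃ c : MonoidAlgebra k G,
      varOp v χ e β i (mon k G m) - c • mon k G (i ::ₘ m) ∈ polyLE k G n m.card := by
  induction i, m using cons_induction with
  | le i m h =>
    refine ⟨1, ?_⟩
    rw [varOp_of_le _ _ _ _ h, one_smul, sub_self]
    exact zero_mem _
  | lt i j m hj h ih1 ih2 =>
    obtain ⟨c, hc⟩ := ih1 i m le_rfl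
    -- Swapping `v i` past `v j` contributes the factor `e i j`, and `v j` then acts on the leading
    -- term by insertion. The bracket term only has degree at most `m.card + 1`.
    refine ⟨e i j • c, ?_⟩
    have h1 : varOp v χ e β j (mon k G (i ::ₘ m)) = mon k G (i ::ₘ j ::ₘ m) := by
      rw [varOp_of_le, Multiset.cons_swap]
      intro b hb
      rcases Multiset.mem_cons.1 hb with rfl | hb
      exacts [hj.le, h b hb]
    have h2 : varOp v χ e β i (mon k G (j ::ₘ m)) - (e i j • c) • mon k G (i ::ₘ j ::ₘ m) =
        e i j • varOp v χ e β j (varOp v χ e β i (mon k G m) - c • mon k G (i ::ₘ m)) +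
        actOf v χ (varOp v χ e β) (β i j) (mon k G m) := by
      rw [varOp_cons _ _ _ _ hj h, map_sub, map_smul, h1, smul_assoc, smul_sub]
      abel
    rw [h2, ← algebraMap_smul (MonoidAlgebra k G), Multiset.card_cons]
    refine add_mem (Submodule.smul_mem _ _ ?_) ?_
    · exact map_polyLE_le (fun m' hm' => polyLE_mono (by omega) (varOp_mem_polyLE v χ e β j m')) hc
    · exact actOf_mem_polyLE v χ
        (fun l m' hm' => polyLE_mono (by omega) (varOp_mem_polyLE v χ e β l m')) _
        (mon_mem_polyLE le_rfl)

end Operators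

/-! ### Homogeneous bases: compatibility with `G` and reduction to basis elements -/

section Frame

variable {k : Type uk} {A : Type uA} {G : Type uG} {V : Type uV} [Field k]
  [CommGroup G] [AddCommGroup V] [Module k V] {n : ℕ}

variable {ρ : Representation k G V} (ε : A → A → kˣ)
    (br : TensorGroupAlgebra ρ →ₗ[k] TensorGroupAlgebra ρ →ₗ[k] TensorGroupAlgebra ρ)
    (v : Module.Basis (Fin n) k V) (d : Fin n → A) (χ : Fin n → G →* k)

/-- The operators on polynomials which give the action of the basis of a color Lie ring. -/
def basisOp : Fin n → Module.End (MonoidAlgebra k G) (Poly k G n) :=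
  varOp v χ (fun i j => (ε (d i) (d j) : k))
    fun i j => br (TensorGroupAlgebra.tmul ρ (v i) 1) (TensorGroupAlgebra.tmul ρ (v j) 1)

/-- The action of a color Lie ring on polynomials. -/
def lieAct : TensorGroupAlgebra ρ →ₗ[k] Module.End (MonoidAlgebra k G) (Poly k G n) :=
  actOf v χ (basisOp ε br v d χ)

theorem lieAct_tmul (i : Fin n) (r : MonoidAlgebra k G) :
    lieAct ε br v d χ (TensorGroupAlgebra.tmul ρ (v i) r) =
      basisOp ε br v d χ i * leftMul χ r :=
  actOf_tmul v χ _ i r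

theorem lieAct_tmul_one (i : Fin n) :
    lieAct ε br v d χ (TensorGroupAlgebra.tmul ρ (v i) 1) = basisOp ε br v d χ i := by
  rw [lieAct_tmul, map_one, mul_one]

theorem lieAct_op_smul (r : MonoidAlgebra k G) (x : TensorGroupAlgebra ρ) :
    lieAct ε br v d χ (MulOpposite.op r • x) = lieAct ε br v d χ x * leftMul χ r :=
  actOf_op_smul v χ _ r x

theorem basisOp_of_le {i : Fin n} {m : Multiset (Fin n)} (h : ∀ b ∈ m, i ≤ b) :
    basisOp ε br v d χ i (mon k G m) = mon k G (i ::ₘ m) :=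
  varOp_of_le v χ _ _ h

theorem basisOp_cons {i j : Fin n} {m : Multiset (Fin n)} (hj : j < i) (h : ∀ b ∈ m, j ≤ b) :
    basisOp ε br v d χ i (mon k G (j ::ₘ m)) =
      (ε (d i) (d j) : k) • basisOp ε br v d χ j (basisOp ε br v d χ i (mon k G m)) +
      lieAct ε br v d χ
        (br (TensorGroupAlgebra.tmul ρ (v i) 1) (TensorGroupAlgebra.tmul ρ (v j) 1))
        (mon k G m) :=
  varOp_cons v χ _ _ hj h

theorem basisOp_mem_polyLE (i : Fin n) (m : Multiset (Fin n)) :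
    basisOp ε br v d χ i (mon k G m) ∈ polyLE k G n (m.card + 1) :=
  varOp_mem_polyLE v χ _ _ i m

theorem exists_basisOp_sub_mem (i : Fin n) (m : Multiset (Fin n)) :
    ∃ c : MonoidAlgebra k G,
      basisOp ε br v d χ i (mon k G m) - c • mon k G (i ::ₘ m) ∈ polyLE k G n m.card :=
  exists_varOp_sub_mem v χ _ _ i m

/-- The basis `v` of `V` is homogeneous of degrees `d`, the elements of `G` have the degrees `δ`,
and `G` acts on `v i` by the character `χ i`, in a purely positive Yetter-Drinfeld color Lie ring
over `kG` for which `ε` is trivial on `G`. -/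
structure IsHomogeneousFrame [CommGroup A] {ρ : Representation k G V} (ε : A → A → kˣ)
    (𝓡 : A → Submodule k (MonoidAlgebra k G)) (𝓛 : A → Submodule k (TensorGroupAlgebra ρ))
    (br : TensorGroupAlgebra ρ →ₗ[k] TensorGroupAlgebra ρ →ₗ[k] TensorGroupAlgebra ρ)
    (v : Module.Basis (Fin n) k V) (d : Fin n → A) (δ : G → A) (χ : Fin n → G →* k) : Prop where
  colorLieRing : IsColorLieRing ε 𝓡 𝓛 br
  δ_one : δ 1 = 1
  ε_group : ∀ g h, ε (δ g) (δ h) = 1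
  ε_self : ∀ i, ε (d i) (d i) = 1
  χ_apply : ∀ i g, χ i g = (ε (δ g) (d i) : k)
  action : ∀ g i, ρ g (v i) = χ i g • v i
  tmul_mem : ∀ i g, TensorGroupAlgebra.tmul ρ (v i) (MonoidAlgebra.of k G g) ∈ 𝓛 (d i * δ g)
  mem_span : ∀ {a u}, u ∈ 𝓛 a → u ∈ Submodule.span k {x | ∃ i g, d i * δ g = a ∧
    x = TensorGroupAlgebra.tmul ρ (v i) (MonoidAlgebra.of k G g)}

variable [CommGroup A] {ε br v d χ} {𝓡 : A → Submodule k (MonoidAlgebra k G)}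
  {𝓛 : A → Submodule k (TensorGroupAlgebra ρ)} {δ : G → A}

namespace IsAntisymmBicharacter

theorem mul_comm_eq_one (hε : IsAntisymmBicharacter ε) (a b : A) :
    (ε a b : k) * ε b a = 1 := by
  rw [hε.antisymm a b, Units.mul_inv]

theorem coe_mul_left (hε : IsAntisymmBicharacter ε) (a b c : A) :
    (ε (a * b) c : k) = ε a c * ε b c := by
  rw [hε.mul_left, Units.val_mul]

theorem coe_mul_right (hε : IsAntisymmBicharacter ε) (a b c : A) :
    (ε a (b * c) : k) = ε a b * ε a c := by
  rw [hε.mul_right, Units.val_mul]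

end IsAntisymmBicharacter

namespace IsHomogeneousFrame

variable (h : IsHomogeneousFrame ε 𝓡 𝓛 br v d δ χ)

include h

theorem of_smul_tmul (g : G) (i : Fin n) (r : MonoidAlgebra k G) :
    MonoidAlgebra.of k G g • TensorGroupAlgebra.tmul ρ (v i) r =
      χ i g • TensorGroupAlgebra.tmul ρ (v i) (MonoidAlgebra.of k G g * r) := by
  rw [TensorGroupAlgebra.of_smul_tmul, h.action]
  exact (TensorProduct.smul_tmul' _ _ _).symm

theorem tmul_one_mem (i : Fin n) : TensorGroupAlgebra.tmul ρ (v i) 1 ∈ 𝓛 (d i) := by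
  have := h.tmul_mem i 1
  rwa [h.δ_one, mul_one, map_one] at this

theorem br_tmul_mem (i j : Fin n) :
    br (TensorGroupAlgebra.tmul ρ (v i) 1) (TensorGroupAlgebra.tmul ρ (v j) 1) ∈
      𝓛 (d i * d j) :=
  h.colorLieRing.graded (h.tmul_one_mem i) (h.tmul_one_mem j)

/-- The element `g` crosses to the second argument by balancedness, acts on `v j` by its character,
and then leaves on the right together with `g'`. -/
theorem br_tmul (i j : Fin n) (g g' : G) :
    br (TensorGroupAlgebra.tmul ρ (v i) (MonoidAlgebra.of k G g))
        (TensorGroupAlgebra.tmul ρ (v j) (MonoidAlgebra.of k G g')) =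
      χ j g • MulOpposite.op (MonoidAlgebra.of k G g * MonoidAlgebra.of k G g') •
        br (TensorGroupAlgebra.tmul ρ (v i) 1) (TensorGroupAlgebra.tmul ρ (v j) 1) := by
  rw [← h.colorLieRing.right_linear, TensorGroupAlgebra.op_smul_tmul, one_mul, ← map_smul,
    ← h.of_smul_tmul, ← h.colorLieRing.balanced, TensorGroupAlgebra.op_smul_tmul, one_mul]

/-- A homogeneous element of degree `a` commutes with `g ∈ G` up to `ε(|g|, a)`, if the basis
elements do so. -/
theorem leftMul_lieAct_of {s : ℕ} {g : G}
    (hs : ∀ i, ∀ m : Multiset (Fin n), m.card ≤ s →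
      leftMul χ (MonoidAlgebra.of k G g) (basisOp ε br v d χ i (mon k G m)) =
        χ i g • basisOp ε br v d χ i (leftMul χ (MonoidAlgebra.of k G g) (mon k G m)))
    {a : A} {u : TensorGroupAlgebra ρ} (hu : u ∈ 𝓛 a) {x : Poly k G n}
    (hx : x ∈ polyLE k G n s) :
    leftMul χ (MonoidAlgebra.of k G g) (lieAct ε br v d χ u x) =
      (ε (δ g) a : k) • lieAct ε br v d χ u (leftMul χ (MonoidAlgebra.of k G g) x) := by
  refine Submodule.span_induction (p := fun u _ =>
    leftMul χ (MonoidAlgebra.of k G g) (lieAct ε br v d χ u x) =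
      (ε (δ g) a : k) • lieAct ε br v d χ u (leftMul χ (MonoidAlgebra.of k G g) x))
    ?_ ?_ ?_ ?_ (h.mem_span hu)
  · rintro _ ⟨i, g', rfl, rfl⟩
    have hs' := fun y (hy : y ∈ polyLE k G n s) => eq_on_polyLE
      (f := leftMul χ (MonoidAlgebra.of k G g) * basisOp ε br v d χ i)
      (g := χ i g • (basisOp ε br v d χ i * leftMul χ (MonoidAlgebra.of k G g)))
      (fun m hm => hs i m hm) hy
    rw [lieAct_tmul]
    refine (hs' _ (leftMul_mem_polyLE χ (MonoidAlgebra.of k G g') hx)).trans ?_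
    have hc : leftMul χ (MonoidAlgebra.of k G g') (leftMul χ (MonoidAlgebra.of k G g) x) =
        leftMul χ (MonoidAlgebra.of k G g) (leftMul χ (MonoidAlgebra.of k G g') x) := by
      rw [← Module.End.mul_apply, ← map_mul, mul_comm (MonoidAlgebra.of k G g'), map_mul,
        Module.End.mul_apply]
    -- In `ε(δ g, d i * δ g')` the factor from `g'` is `1`, because `ε` is trivial on `G`; only `χ i
    -- g` remains.
    rw [h.colorLieRing.bicharacter.coe_mul_right, h.ε_group, Units.val_one, mul_one, h.χ_apply,
      LinearMap.smul_apply, Module.End.mul_apply, Module.End.mul_apply, hc]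
  · simp
  · intro u w _ _ hu hw
    simp only [map_add, LinearMap.add_apply, hu, hw, smul_add]
  · intro c u _ hu
    rw [map_smul, LinearMap.smul_apply, LinearMap.map_smul_of_tower, hu, LinearMap.smul_apply,
      smul_comm]

/-- Both terms of the recursion rescale alike: `[v i, v j]` has degree `d i * d j`, so `g` crosses
it with the factor `χ i g * χ j g`, as it does `v j v i`. -/
theorem leftMul_basisOp_mon (g : G) (i : Fin n) (m : Multiset (Fin n)) :
    leftMul χ (MonoidAlgebra.of k G g) (basisOp ε br v d χ i (mon k G m)) =
      χ i g • basisOp ε br v d χ i (leftMul χ (MonoidAlgebra.of k G g) (mon k G m)) := by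
  induction i, m using cons_induction with
  | le i m hm =>
    rw [basisOp_of_le _ _ _ _ _ hm, leftMul_of_mon, leftMul_of_mon, map_smul,
      basisOp_of_le _ _ _ _ _ hm, weight_cons, MonoidHom.mul_apply, ← smul_assoc, smul_smul]
  | lt i j m hj hm ih1 ih2 =>
    have h1 := eq_on_polyLE
      (f := leftMul χ (MonoidAlgebra.of k G g) * basisOp ε br v d χ j)
      (g := χ j g • (basisOp ε br v d χ j * leftMul χ (MonoidAlgebra.of k G g)))
      (fun m hm => ih2 m hm) (basisOp_mem_polyLE ε br v d χ i m)
    simp only [Module.End.mul_apply, LinearMap.smul_apply] at h1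
    have h2 : (ε (δ g) (d i * d j) : k) = χ i g * χ j g := by
      rw [h.colorLieRing.bicharacter.coe_mul_right, h.χ_apply, h.χ_apply]
    rw [leftMul_of_mon, weight_cons, MonoidHom.mul_apply, map_smul, basisOp_cons _ _ _ _ _ hj hm,
      map_add, LinearMap.map_smul_of_tower, h1, ih1 i m le_rfl,
      h.leftMul_lieAct_of ih1 (h.br_tmul_mem i j) (mon_mem_polyLE le_rfl), h2, leftMul_of_mon]
    simp only [map_smul, LinearMap.map_smul_of_tower, smul_assoc, smul_add, smul_smul]
    simp only [smul_comm (MonoidAlgebra.of k G g), smul_smul]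
    congr 2 <;> ring

theorem leftMul_mul_basisOp (g : G) (i : Fin n) :
    leftMul χ (MonoidAlgebra.of k G g) * basisOp ε br v d χ i =
      χ i g • (basisOp ε br v d χ i * leftMul χ (MonoidAlgebra.of k G g)) :=
  poly_hom_ext fun m => h.leftMul_basisOp_mon g i m

theorem lieAct_smul (r : MonoidAlgebra k G) (u : TensorGroupAlgebra ρ) :
    lieAct ε br v d χ (r • u) = leftMul χ r * lieAct ε br v d χ u := by
  induction r using MonoidAlgebra.induction_on with
  | of g =>
    induction u using tmul_induction v with
    | tmul i g' =>
      rw [h.of_smul_tmul, map_smul, lieAct_tmul, lieAct_tmul, ← mul_assoc, h.leftMul_mul_basisOp,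
        map_mul, smul_mul_assoc, mul_assoc]
    | add a b ha hb => rw [smul_add, map_add, map_add, ha, hb, mul_add]
    | smul c a ha => rw [smul_comm, map_smul _ c, map_smul _ c, ha, mul_smul_comm]
    | zero => rw [smul_zero, map_zero, mul_zero]
  | add a b ha hb => rw [add_smul, map_add, map_add, ha, hb, add_mul]
  | smul c a ha => rw [smul_assoc, map_smul _ c, map_smul _ c, ha, smul_mul_assoc]

/-- If the operators of the basis satisfy the relations of the enveloping algebra at all multiples
of the monomial `m`, so do those of all homogeneous elements. -/
theorem lieAct_lieAct_mon {m : Multiset (Fin n)}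
    (hm : ∀ i j, basisOp ε br v d χ i (basisOp ε br v d χ j (mon k G m)) =
      (ε (d i) (d j) : k) • basisOp ε br v d χ j (basisOp ε br v d χ i (mon k G m)) +
      lieAct ε br v d χ
        (br (TensorGroupAlgebra.tmul ρ (v i) 1) (TensorGroupAlgebra.tmul ρ (v j) 1)) (mon k G m))
    {a b : A} {u w : TensorGroupAlgebra ρ} (hu : u ∈ 𝓛 a) (hw : w ∈ 𝓛 b) :
    lieAct ε br v d χ u (lieAct ε br v d χ w (mon k G m)) =
      (ε a b : k) • lieAct ε br v d χ w (lieAct ε br v d χ u (mon k G m)) +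
      lieAct ε br v d χ (br u w) (mon k G m) := by
  refine Submodule.span_induction₂ (p := fun u w _ _ =>
    lieAct ε br v d χ u (lieAct ε br v d χ w (mon k G m)) =
      (ε a b : k) • lieAct ε br v d χ w (lieAct ε br v d χ u (mon k G m)) +
      lieAct ε br v d χ (br u w) (mon k G m)) ?_ ?_ ?_ ?_ ?_ ?_ ?_ (h.mem_span hu) (h.mem_span hw)
  · rintro _ _ ⟨i, g, rfl, rfl⟩ ⟨j, g', rfl, rfl⟩
    have key (i j : Fin n) (g g' : G) (x : Poly k G n) :
        (lieAct ε br v d χ (TensorGroupAlgebra.tmul ρ (v i) (MonoidAlgebra.of k G g))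
          (lieAct ε br v d χ (TensorGroupAlgebra.tmul ρ (v j) (MonoidAlgebra.of k G g')) x)) =
        χ j g • basisOp ε br v d χ i (basisOp ε br v d χ j
          (leftMul χ (MonoidAlgebra.of k G g * MonoidAlgebra.of k G g') x)) := by
      have := h.leftMul_mul_basisOp g j
      rw [lieAct_tmul, lieAct_tmul, ← Module.End.mul_apply, mul_assoc, ← mul_assoc (leftMul χ _),
        this, smul_mul_assoc, mul_smul_comm, mul_assoc, ← map_mul]
      rfl
    -- Both orders of the product let `g g'` act on `m` first. This gives `t • m`, and `t` passes
    -- through the `kG`-linear operators, so the relations at `m` suffice.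
    obtain ⟨t, ht⟩ := exists_leftMul_mon χ (MonoidAlgebra.of k G g * MonoidAlgebra.of k G g') m
    have hε := h.colorLieRing.bicharacter
    rw [key, key, mul_comm (MonoidAlgebra.of k G g'), h.br_tmul, map_smul, LinearMap.smul_apply,
      lieAct_op_smul, Module.End.mul_apply, ht]
    simp only [map_smul]
    rw [hm, smul_smul, hε.coe_mul_left, hε.coe_mul_right, hε.coe_mul_right, h.ε_group,
      h.χ_apply, h.χ_apply, Units.val_one]
    -- Antisymmetry cancels `ε (d i) (δ g')` against the factor `χ i g'` from moving `g'` past `v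
    -- i`.
    have h1 : (ε (d i) (d j) * ε (d i) (δ g') * (ε (δ g) (d j) * 1) * ε (δ g') (d i) : k) =
        ε (δ g) (d j) * ε (d i) (d j) := by
      linear_combination (ε (d i) (d j) * ε (δ g) (d j) : k) *
        hε.mul_comm_eq_one (d i) (δ g')
    rw [h1, smul_add, smul_add, smul_comm t, smul_smul]
  · intro y _; simp
  · intro x _; simp
  · intro x y z _ _ _ hx hy
    simp only [map_add, LinearMap.add_apply, hx, hy, smul_add]
    abel
  · intro x y z _ _ _ hx hy
    simp only [map_add, LinearMap.add_apply, hx, hy, smul_add]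
    abel
  · intro c x y _ _ hx
    simp only [map_smul, LinearMap.smul_apply, LinearMap.map_smul_of_tower, hx, smul_add]
    rw [smul_comm c]
  · intro c x y _ _ hx
    simp only [map_smul, LinearMap.smul_apply, LinearMap.map_smul_of_tower, hx, smul_add]
    rw [smul_comm c]

end IsHomogeneousFrame

end Frame

/-! ### The commutation relations, from the Jacobi identity -/

section Commutation

variable {k : Type uk} {A : Type uA} {G : Type uG} {V : Type uV} [Field k] [CommGroup G]
  [AddCommGroup V] [Module k V] {n : ℕ} {ρ : Representation k G V}
  {ε : A → A → kˣ}
  {br : TensorGroupAlgebra ρ →ₗ[k] TensorGroupAlgebra ρ →ₗ[k] TensorGroupAlgebra ρ}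
  {v : Module.Basis (Fin n) k V} {d : Fin n → A} {χ : Fin n → G →* k}

/-- The relation for `v i` and `v l` holds at `v j * m`, if `l` is less than `i`, `j` and all the
variables of `m` and the relations hold at all monomials whose degree is at most that of `m`. -/
theorem basisOp_basisOp_basisOp {i j l : Fin n} {m : Multiset (Fin n)} (hl : ∀ b ∈ m, l ≤ b)
    (hlj : l < j) (hli : l < i)
    (hm : ∀ m' : Multiset (Fin n), m'.card ≤ m.card → ∀ i j,
      basisOp ε br v d χ i (basisOp ε br v d χ j (mon k G m')) =
      (ε (d i) (d j) : k) • basisOp ε br v d χ j (basisOp ε br v d χ i (mon k G m')) +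
      lieAct ε br v d χ
        (br (TensorGroupAlgebra.tmul ρ (v i) 1) (TensorGroupAlgebra.tmul ρ (v j) 1))
        (mon k G m')) :
    basisOp ε br v d χ i (basisOp ε br v d χ l (basisOp ε br v d χ j (mon k G m))) =
      (ε (d i) (d l) : k) •
        basisOp ε br v d χ l (basisOp ε br v d χ i (basisOp ε br v d χ j (mon k G m))) +
      lieAct ε br v d χ
        (br (TensorGroupAlgebra.tmul ρ (v i) 1) (TensorGroupAlgebra.tmul ρ (v l) 1))
        (basisOp ε br v d χ j (mon k G m)) := by
  obtain ⟨c, hc⟩ := exists_basisOp_sub_mem ε br v d χ j m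
  set y := basisOp ε br v d χ j (mon k G m) with hy
  have hjm : ∀ b ∈ j ::ₘ m, l ≤ b := by
    intro b hb
    rcases Multiset.mem_cons.1 hb with rfl | hb
    exacts [hlj.le, hl b hb]
  let P := basisOp ε br v d χ i * basisOp ε br v d χ l
  let Q := (ε (d i) (d l) : k) • (basisOp ε br v d χ l * basisOp ε br v d χ i) +
    lieAct ε br v d χ
      (br (TensorGroupAlgebra.tmul ρ (v i) 1) (TensorGroupAlgebra.tmul ρ (v l) 1))
  have h1 : P (y - c • mon k G (j ::ₘ m)) = Q (y - c • mon k G (j ::ₘ m)) :=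
    eq_on_polyLE (fun m' hm' => hm m' hm' i l) hc
  -- As `l` is least in `j ::ₘ m`, the relation there is the defining recursion. The remainder of
  -- `y` after this leading term is covered by `hm`, and `kG`-linearity makes `c` immaterial.
  have h2 : P (mon k G (j ::ₘ m)) = Q (mon k G (j ::ₘ m)) := by
    change basisOp ε br v d χ i (basisOp ε br v d χ l (mon k G (j ::ₘ m))) = _
    rw [basisOp_of_le _ _ _ _ _ hjm, basisOp_cons _ _ _ _ _ hli hjm]
    rfl
  have h3 : P y = Q y := by
    rw [← sub_add_cancel y (c • mon k G (j ::ₘ m)), map_add, map_add, h1, map_smul, map_smul, h2]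
  exact h3

namespace IsHomogeneousFrame

variable [CommGroup A] {𝓡 : A → Submodule k (MonoidAlgebra k G)}
  {𝓛 : A → Submodule k (TensorGroupAlgebra ρ)} {δ : G → A}
  (h : IsHomogeneousFrame ε 𝓡 𝓛 br v d δ χ)

include h

/-- If `j` is at most all variables of `m`, this is the recursion. Otherwise the least variable `l <
j < i` of `m` is split off, and both `v i v j v l` and `v j v i v l` are expanded so that `v l`
moves to the front. All relations needed are then available in smaller degree or from the recursion,
and the double brackets left over cancel by Jacobi. -/
theorem basisOp_basisOp_of_lt {i j : Fin n} {m : Multiset (Fin n)} (hji : j < i)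
    (hm : ∀ m' : Multiset (Fin n), m'.card < m.card → ∀ i j,
      basisOp ε br v d χ i (basisOp ε br v d χ j (mon k G m')) =
      (ε (d i) (d j) : k) • basisOp ε br v d χ j (basisOp ε br v d χ i (mon k G m')) +
      lieAct ε br v d χ
        (br (TensorGroupAlgebra.tmul ρ (v i) 1) (TensorGroupAlgebra.tmul ρ (v j) 1))
        (mon k G m')) :
    basisOp ε br v d χ i (basisOp ε br v d χ j (mon k G m)) =
      (ε (d i) (d j) : k) • basisOp ε br v d χ j (basisOp ε br v d χ i (mon k G m)) +
      lieAct ε br v d χ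
        (br (TensorGroupAlgebra.tmul ρ (v i) 1) (TensorGroupAlgebra.tmul ρ (v j) 1))
        (mon k G m) := by
  rcases forall_le_or_exists_cons j m with hj | ⟨l, m, rfl, hlj, hl⟩
  · rw [basisOp_of_le _ _ _ _ _ hj, basisOp_cons _ _ _ _ _ hji hj]
  have hm' : ∀ m' : Multiset (Fin n), m'.card ≤ m.card → ∀ i j,
      basisOp ε br v d χ i (basisOp ε br v d χ j (mon k G m')) =
      (ε (d i) (d j) : k) • basisOp ε br v d χ j (basisOp ε br v d χ i (mon k G m')) +
      lieAct ε br v d χ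
        (br (TensorGroupAlgebra.tmul ρ (v i) 1) (TensorGroupAlgebra.tmul ρ (v j) 1))
        (mon k G m') := fun m' h' => hm m' (by rw [Multiset.card_cons]; omega)
  have hε := h.colorLieRing.bicharacter
  have E1 := basisOp_cons ε br v d χ hlj hl
  have E2 := basisOp_cons ε br v d χ (hlj.trans hji) hl
  have E3 := basisOp_basisOp_basisOp hl hlj (hlj.trans hji) hm'
  have E4 := basisOp_basisOp_basisOp hl (hlj.trans hji) hlj hm'
  have E5 := hm' m le_rfl i j
  have E0 := basisOp_of_le ε br v d χ hl
  have E6 := h.lieAct_lieAct_mon (hm' m le_rfl) (h.tmul_one_mem i) (h.br_tmul_mem j l)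
  have E7 := h.lieAct_lieAct_mon (hm' m le_rfl) (h.tmul_one_mem j) (h.br_tmul_mem i l)
  have E8 := h.lieAct_lieAct_mon (hm' m le_rfl) (h.tmul_one_mem l) (h.br_tmul_mem i j)
  have J := h.colorLieRing.jacobi (h.tmul_one_mem i) (h.tmul_one_mem j) (h.tmul_one_mem l)
  -- Jacobi produces `[v l, v i]`, while the expansions contain `[v i, v l]`.
  rw [h.colorLieRing.antisymm (h.tmul_one_mem l) (h.tmul_one_mem i)] at J
  replace J := LinearMap.congr_fun (congrArg (lieAct ε br v d χ) J) (mon k G m)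
  simp only [lieAct_tmul_one, hε.coe_mul_right] at E6 E7 E8
  simp only [map_add, map_smul, map_neg, map_zero, LinearMap.add_apply, LinearMap.smul_apply,
    LinearMap.neg_apply, LinearMap.zero_apply, smul_neg] at J
  have hij := hε.mul_comm_eq_one (d i) (d j)
  have hil := hε.mul_comm_eq_one (d i) (d l)
  have hjl := hε.mul_comm_eq_one (d j) (d l)
  rw [E1, E2, map_add, map_add, LinearMap.map_smul_of_tower, LinearMap.map_smul_of_tower, E3, E4,
    E5, E6, E7]
  rw [E0] at E8
  rw [map_add, LinearMap.map_smul_of_tower, E8]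
  generalize (ε (d i) (d j) : k) = eij at *
  generalize (ε (d j) (d i) : k) = eji at *
  generalize (ε (d i) (d l) : k) = eil at *
  generalize (ε (d l) (d i) : k) = eli at *
  generalize (ε (d j) (d l) : k) = ejl at *
  generalize (ε (d l) (d j) : k) = elj at *
  generalize lieAct ε br v d χ (br (TensorGroupAlgebra.tmul ρ (v i) 1)
    (br (TensorGroupAlgebra.tmul ρ (v j) 1) (TensorGroupAlgebra.tmul ρ (v l) 1))) (mon k G m) = p
    at *
  generalize lieAct ε br v d χ (br (TensorGroupAlgebra.tmul ρ (v j) 1)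
    (br (TensorGroupAlgebra.tmul ρ (v i) 1) (TensorGroupAlgebra.tmul ρ (v l) 1))) (mon k G m) = q
    at *
  generalize lieAct ε br v d χ (br (TensorGroupAlgebra.tmul ρ (v i) 1)
    (TensorGroupAlgebra.tmul ρ (v j) 1)) (mon k G (l ::ₘ m)) = M at *
  generalize lieAct ε br v d χ (br (TensorGroupAlgebra.tmul ρ (v i) 1)
    (TensorGroupAlgebra.tmul ρ (v l) 1)) (basisOp ε br v d χ j (mon k G m)) = C at *
  -- Multiplying Jacobi by `eil` matches the double brackets; the other summands only replace
  -- products `ε a b * ε b a` by `1`.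
  linear_combination (norm := module) eil • J + (hjl * (eil * eli) + hil) • M -
    (ejl * hij) • C - hil • p + (eij * hil) • q

theorem basisOp_basisOp [CharZero k] (i j : Fin n) (m : Multiset (Fin n)) :
    basisOp ε br v d χ i (basisOp ε br v d χ j (mon k G m)) =
      (ε (d i) (d j) : k) • basisOp ε br v d χ j (basisOp ε br v d χ i (mon k G m)) +
      lieAct ε br v d χ
        (br (TensorGroupAlgebra.tmul ρ (v i) 1) (TensorGroupAlgebra.tmul ρ (v j) 1))
        (mon k G m) := by
  induction hs : m.card using Nat.strong_induction_on generalizing i j m with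
  | h s ih =>
    have hm : ∀ m' : Multiset (Fin n), m'.card < m.card → ∀ i j,
        basisOp ε br v d χ i (basisOp ε br v d χ j (mon k G m')) =
        (ε (d i) (d j) : k) • basisOp ε br v d χ j (basisOp ε br v d χ i (mon k G m')) +
        lieAct ε br v d χ
          (br (TensorGroupAlgebra.tmul ρ (v i) 1) (TensorGroupAlgebra.tmul ρ (v j) 1))
          (mon k G m') := fun m' h' i j => ih m'.card (by omega) i j m' rfl
    have anti := h.colorLieRing.antisymm (h.tmul_one_mem i) (h.tmul_one_mem j)
    rcases lt_trichotomy j i with hji | rfl | hij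
    · exact h.basisOp_basisOp_of_lt hji hm
    -- With `ε(d i, d i) = 1`, antisymmetry says `2 [v i, v i] = 0`, so the bracket vanishes in
    -- characteristic `0`.
    · rw [h.ε_self, Units.val_one, one_smul, eq_neg_iff_add_eq_zero, ← two_smul k] at anti
      rw [(smul_eq_zero.1 anti).resolve_left two_ne_zero, h.ε_self, Units.val_one, one_smul,
        map_zero, LinearMap.zero_apply, add_zero]
    -- The relation for `(i, j)` is that for `(j, i)` multiplied by `ε(d i, d j)`, the inverse of
    -- `ε(d j, d i)`.
    · rw [h.basisOp_basisOp_of_lt hij hm, anti, map_neg, map_smul, LinearMap.neg_apply,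
        LinearMap.smul_apply, smul_add, smul_smul,
        h.colorLieRing.bicharacter.mul_comm_eq_one, one_smul, add_neg_cancel_right]

theorem lieAct_mul_lieAct [CharZero k] {a b : A} {u w : TensorGroupAlgebra ρ} (hu : u ∈ 𝓛 a)
    (hw : w ∈ 𝓛 b) :
    lieAct ε br v d χ u * lieAct ε br v d χ w =
      (ε a b : k) • (lieAct ε br v d χ w * lieAct ε br v d χ u) + lieAct ε br v d χ (br u w) :=
  poly_hom_ext fun m => h.lieAct_lieAct_mon (fun i j => h.basisOp_basisOp i j m) hu hw

end IsHomogeneousFrame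

end Commutation

/-! ### Relations and universal property of the enveloping algebra -/

namespace Enveloping

variable {k : Type uk} {A : Type uA} {R : Type uR} {L : Type uL} [Field k]
    [Ring R] [Algebra k R] [AddCommGroup L] [Module k L] [Module R L] [Module Rᵐᵒᵖ L]
    (ε : A → A → kˣ) (𝓛 : A → Submodule k L) (br : L →ₗ[k] L →ₗ[k] L)

theorem ofRing_one : ofRing R ε 𝓛 br 1 = 1 :=
  (congrArg (mk R ε 𝓛 br) TensorRing.ofRing_one).trans (map_one _)

theorem ofRing_mul (r s : R) : ofRing R ε 𝓛 br (r * s) = ofRing R ε 𝓛 br r * ofRing R ε 𝓛 br s :=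
  (congrArg (mk R ε 𝓛 br) (TensorRing.ofRing_mul r s)).trans (map_mul _ _ _)

theorem ι_smul (r : R) (x : L) : ι R ε 𝓛 br (r • x) = ofRing R ε 𝓛 br r * ι R ε 𝓛 br x :=
  (congrArg (mk R ε 𝓛 br) (TensorRing.ι_smul r x)).trans (map_mul _ _ _)

theorem ι_op_smul (r : R) (x : L) :
    ι R ε 𝓛 br (MulOpposite.op r • x) = ι R ε 𝓛 br x * ofRing R ε 𝓛 br r :=
  (congrArg (mk R ε 𝓛 br) (TensorRing.ι_op_smul r x)).trans (map_mul _ _ _)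

variable {𝓛} in
theorem ι_mul_ι {a b : A} {u w : L} (hu : u ∈ 𝓛 a) (hw : w ∈ 𝓛 b) :
    ι R ε 𝓛 br u * ι R ε 𝓛 br w =
      (ε a b : k) • (ι R ε 𝓛 br w * ι R ε 𝓛 br u) + ι R ε 𝓛 br (br u w) := by
  have := RingQuot.mkAlgHom_rel k (EnvelopingRel.bracket (R := R) (ε := ε) (br := br) hu hw)
  rw [map_mul, map_add, map_smul, map_mul] at this
  exact this

@[elab_as_elim]
theorem induction_on {motive : Enveloping R ε 𝓛 br → Prop} (x : Enveloping R ε 𝓛 br)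
    (ofRing : ∀ r, motive (ofRing R ε 𝓛 br r)) (ι : ∀ y, motive (ι R ε 𝓛 br y))
    (add : ∀ x y, motive x → motive y → motive (x + y))
    (mul : ∀ x y, motive x → motive y → motive (x * y)) : motive x := by
  obtain ⟨y, rfl⟩ := RingQuot.mkAlgHom_surjective k (EnvelopingRel (R := R) ε 𝓛 br) x
  obtain ⟨z, rfl⟩ := RingQuot.mkAlgHom_surjective k (TensorRingRel k R L) y
  change motive (mk R ε 𝓛 br (TensorRing.mk k R L z))
  induction z using TensorAlgebra.induction with
  | algebraMap c =>
    rw [Algebra.algebraMap_eq_smul_one, map_smul, map_smul, map_one, map_one,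
      ← ofRing_one ε 𝓛 br, ← map_smul]
    exact ofRing _
  | ι p =>
    have : p = (p.1, 0) + (0, p.2) := by simp
    rw [this, map_add, map_add, map_add]
    exact add _ _ (ofRing p.1) (ι p.2)
  | mul a b ha hb =>
    rw [map_mul, map_mul]
    exact mul _ _ ha hb
  | add a b ha hb =>
    rw [map_add, map_add]
    exact add _ _ ha hb

theorem exists_lift {B : Type*} [Ring B] [Algebra k B] (f : R →ₐ[k] B) (φ : L →ₗ[k] B)
    (hl : ∀ (r : R) (x : L), φ (r • x) = f r * φ x)
    (hr : ∀ (r : R) (x : L), φ (MulOpposite.op r • x) = φ x * f r)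
    (hbr : ∀ {a b : A} {u w : L}, u ∈ 𝓛 a → w ∈ 𝓛 b →
      φ u * φ w = (ε a b : k) • (φ w * φ u) + φ (br u w)) :
    ∃ F : Enveloping R ε 𝓛 br →ₐ[k] B,
      (∀ r, F (ofRing R ε 𝓛 br r) = f r) ∧ ∀ x, F (ι R ε 𝓛 br x) = φ x := by
  obtain ⟨F, ⟨hF1, hF2⟩, -⟩ := TensorRing.existsUnique_lift f φ hl hr
  have hrel : ∀ ⦃x y⦄, EnvelopingRel (R := R) ε 𝓛 br x y → F x = F y := by
    rintro _ _ ⟨hu, hw⟩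
    rw [map_add, map_smul, map_mul, map_mul, hF2, hF2, hF2, hbr hu hw]
  refine ⟨RingQuot.liftAlgHom k ⟨F, hrel⟩, fun r => ?_, fun x => ?_⟩
  · exact (RingQuot.liftAlgHom_mkAlgHom_apply k F hrel _).trans (hF1 r)
  · exact (RingQuot.liftAlgHom_mkAlgHom_apply k F hrel _).trans (hF2 x)

end Enveloping

/-! ### The ordered product map and its inverse -/

section PBWMap

variable {k : Type uk} {A : Type uA} {G : Type uG} {V : Type uV} [Field k] [CommGroup G]
  [AddCommGroup V] [Module k V] {n : ℕ} {ρ : Representation k G V}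
  (ε : A → A → kˣ) (𝓛 : A → Submodule k (TensorGroupAlgebra ρ))
  (br : TensorGroupAlgebra ρ →ₗ[k] TensorGroupAlgebra ρ →ₗ[k] TensorGroupAlgebra ρ)
  (v : Module.Basis (Fin n) k V)

/-- The image of `v i ⊗ 1` in the enveloping algebra. -/
def envVar (i : Fin n) : Enveloping (MonoidAlgebra k G) ε 𝓛 br :=
  Enveloping.ι (MonoidAlgebra k G) ε 𝓛 br (TensorGroupAlgebra.tmul ρ (v i) 1)

/-- The linear map from polynomials to the enveloping algebra which takes a monomial to the ordered
product of its variables. -/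
def orderedProd : Poly k G n →ₗ[k] Enveloping (MonoidAlgebra k G) ε 𝓛 br :=
  Finsupp.lsum k fun m =>
    LinearMap.mulLeft k (m.sort.map (envVar ε 𝓛 br v)).prod ∘ₗ
      Enveloping.ofRing (MonoidAlgebra k G) ε 𝓛 br

theorem orderedProd_single (m : Multiset (Fin n)) (r : MonoidAlgebra k G) :
    orderedProd ε 𝓛 br v (Finsupp.single m r) =
      (m.sort.map (envVar ε 𝓛 br v)).prod * Enveloping.ofRing (MonoidAlgebra k G) ε 𝓛 br r := by
  rw [orderedProd, Finsupp.lsum_single]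
  rfl

theorem orderedProd_mon (m : Multiset (Fin n)) :
    orderedProd ε 𝓛 br v (mon k G m) = (m.sort.map (envVar ε 𝓛 br v)).prod := by
  rw [orderedProd_single, Enveloping.ofRing_one, mul_one]

theorem orderedProd_mon_cons {i : Fin n} {m : Multiset (Fin n)} (h : ∀ b ∈ m, i ≤ b) :
    orderedProd ε 𝓛 br v (mon k G (i ::ₘ m)) =
      envVar ε 𝓛 br v i * orderedProd ε 𝓛 br v (mon k G m) := by
  rw [orderedProd_mon, orderedProd_mon, Multiset.sort_cons _ _ _ h, List.map_cons, List.prod_cons]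

/-- Scalars on `Poly` become right multiplication; commutativity of `kG` makes this consistent with
a left module. -/
theorem orderedProd_smul (r : MonoidAlgebra k G) (x : Poly k G n) :
    orderedProd ε 𝓛 br v (r • x) =
      orderedProd ε 𝓛 br v x * Enveloping.ofRing (MonoidAlgebra k G) ε 𝓛 br r := by
  induction x using Finsupp.induction_linear with
  | zero => simp
  | add x y hx hy => rw [smul_add, map_add, map_add, hx, hy, add_mul]
  | single m s =>
    rw [Finsupp.smul_single, orderedProd_single, orderedProd_single, smul_eq_mul, mul_comm r,
      Enveloping.ofRing_mul, mul_assoc]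

/-- Left multiplication by `u` commutes with right multiplication by `kG`, so monomials suffice. The
degree bound makes this usable inside the induction for `orderedProd_basisOp_mon`. -/
theorem orderedProd_apply_of_polyLE {s : ℕ}
    {f : Module.End (MonoidAlgebra k G) (Poly k G n)} {u : Enveloping (MonoidAlgebra k G) ε 𝓛 br}
    (h : ∀ m : Multiset (Fin n), m.card ≤ s →
      orderedProd ε 𝓛 br v (f (mon k G m)) = u * orderedProd ε 𝓛 br v (mon k G m))
    {x : Poly k G n} (hx : x ∈ polyLE k G n s) :
    orderedProd ε 𝓛 br v (f x) = u * orderedProd ε 𝓛 br v x := by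
  refine Submodule.span_induction (p := fun x _ =>
    orderedProd ε 𝓛 br v (f x) = u * orderedProd ε 𝓛 br v x) ?_ ?_ ?_ ?_ hx
  · rintro _ ⟨m, hm, rfl⟩
    exact h m hm
  · simp
  · intro x y _ _ hx hy
    rw [map_add, map_add, map_add, hx, hy, mul_add]
  · intro r x _ hx
    rw [map_smul, orderedProd_smul, orderedProd_smul, hx, mul_assoc]

theorem orderedProd_apply {f : Module.End (MonoidAlgebra k G) (Poly k G n)}
    {u : Enveloping (MonoidAlgebra k G) ε 𝓛 br}
    (h : ∀ m : Multiset (Fin n),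
      orderedProd ε 𝓛 br v (f (mon k G m)) = u * orderedProd ε 𝓛 br v (mon k G m))
    (x : Poly k G n) : orderedProd ε 𝓛 br v (f x) = u * orderedProd ε 𝓛 br v x := by
  induction x using Finsupp.induction_linear with
  | zero => simp
  | add x y hx hy => rw [map_add, map_add, map_add, hx, hy, mul_add]
  | single m r =>
    have : (Finsupp.single m r : Poly k G n) = r • mon k G m := by simp
    rw [this, map_smul, orderedProd_smul, orderedProd_smul, h, mul_assoc]

variable {ε 𝓛 br v} [CommGroup A] {𝓡 : A → Submodule k (MonoidAlgebra k G)} {d : Fin n → A}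
  {δ : G → A} {χ : Fin n → G →* k}

namespace IsHomogeneousFrame

variable (h : IsHomogeneousFrame ε 𝓡 𝓛 br v d δ χ)

include h

theorem ofRing_mul_list_prod (g : G) (l : List (Fin n)) :
    Enveloping.ofRing (MonoidAlgebra k G) ε 𝓛 br (MonoidAlgebra.of k G g) *
        (l.map (envVar ε 𝓛 br v)).prod =
      (l.map χ).prod g • ((l.map (envVar ε 𝓛 br v)).prod *
        Enveloping.ofRing (MonoidAlgebra k G) ε 𝓛 br (MonoidAlgebra.of k G g)) := by
  induction l with
  | nil => simp
  | cons i l ih =>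
    have h1 : Enveloping.ofRing (MonoidAlgebra k G) ε 𝓛 br (MonoidAlgebra.of k G g) *
        envVar ε 𝓛 br v i = χ i g • (envVar ε 𝓛 br v i *
          Enveloping.ofRing (MonoidAlgebra k G) ε 𝓛 br (MonoidAlgebra.of k G g)) := by
      rw [envVar, ← Enveloping.ι_smul, ← Enveloping.ι_op_smul, ← map_smul, h.of_smul_tmul,
        TensorGroupAlgebra.op_smul_tmul, mul_one, one_mul]
    rw [List.map_cons, List.prod_cons, List.map_cons, List.prod_cons, ← mul_assoc, h1,
      smul_mul_assoc, mul_assoc, ih, mul_smul_comm, smul_smul, MonoidHom.mul_apply, mul_assoc]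

theorem orderedProd_leftMul (r : MonoidAlgebra k G) (x : Poly k G n) :
    orderedProd ε 𝓛 br v (leftMul χ r x) =
      Enveloping.ofRing (MonoidAlgebra k G) ε 𝓛 br r * orderedProd ε 𝓛 br v x := by
  induction r using MonoidAlgebra.induction_on with
  | add a b ha hb => rw [map_add, map_add, LinearMap.add_apply, map_add, ha, hb, add_mul]
  | smul c a ha =>
    rw [map_smul, map_smul, LinearMap.smul_apply, map_smul, ha, smul_mul_assoc]
  | of g =>
    refine orderedProd_apply ε 𝓛 br v (fun m => ?_) x
    have hw : weight χ m = (m.sort.map χ).prod := by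
      rw [weight, ← Multiset.prod_coe, ← Multiset.map_coe, Multiset.sort_eq]
    rw [leftMul_of_mon, smul_assoc, map_smul, orderedProd_smul, orderedProd_mon,
      h.ofRing_mul_list_prod, hw]

theorem orderedProd_lieAct_of {s : ℕ}
    (hs : ∀ i, ∀ m : Multiset (Fin n), m.card ≤ s →
      orderedProd ε 𝓛 br v (basisOp ε br v d χ i (mon k G m)) =
        envVar ε 𝓛 br v i * orderedProd ε 𝓛 br v (mon k G m))
    (u : TensorGroupAlgebra ρ) {x : Poly k G n} (hx : x ∈ polyLE k G n s) :
    orderedProd ε 𝓛 br v (lieAct ε br v d χ u x) =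
      Enveloping.ι (MonoidAlgebra k G) ε 𝓛 br u * orderedProd ε 𝓛 br v x := by
  induction u using tmul_induction v with
  | tmul i g =>
    rw [lieAct_tmul, Module.End.mul_apply,
      orderedProd_apply_of_polyLE ε 𝓛 br v (hs i) (leftMul_mem_polyLE χ _ hx),
      h.orderedProd_leftMul, ← mul_assoc, envVar, ← Enveloping.ι_op_smul,
      TensorGroupAlgebra.op_smul_tmul, one_mul]
  | add a b ha hb => rw [map_add, map_add, LinearMap.add_apply, map_add, ha, hb, add_mul]
  | smul c a ha =>
    rw [map_smul, map_smul, LinearMap.smul_apply, map_smul, ha, smul_mul_assoc]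
  | zero => simp

/-- Each step of the recursion mirrors a defining relation of the enveloping algebra, so the Jacobi
identity plays no role here. -/
theorem orderedProd_basisOp_mon (i : Fin n) (m : Multiset (Fin n)) :
    orderedProd ε 𝓛 br v (basisOp ε br v d χ i (mon k G m)) =
      envVar ε 𝓛 br v i * orderedProd ε 𝓛 br v (mon k G m) := by
  induction i, m using cons_induction with
  | le i m hm => rw [basisOp_of_le _ _ _ _ _ hm, orderedProd_mon_cons _ _ _ _ hm]
  | lt i j m hj hm ih1 ih2 =>
    rw [basisOp_cons _ _ _ _ _ hj hm, orderedProd_mon_cons _ _ _ _ hm, map_add, map_smul,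
      orderedProd_apply_of_polyLE ε 𝓛 br v ih2 (basisOp_mem_polyLE ε br v d χ i m),
      ih1 i m le_rfl, h.orderedProd_lieAct_of ih1 _ (mon_mem_polyLE le_rfl), ← mul_assoc,
      ← mul_assoc, ← smul_mul_assoc, ← add_mul, envVar, envVar,
      ← Enveloping.ι_mul_ι ε br (h.tmul_one_mem i) (h.tmul_one_mem j)]

theorem orderedProd_lieAct (u : TensorGroupAlgebra ρ) (x : Poly k G n) :
    orderedProd ε 𝓛 br v (lieAct ε br v d χ u x) =
      Enveloping.ι (MonoidAlgebra k G) ε 𝓛 br u * orderedProd ε 𝓛 br v x :=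
  orderedProd_apply ε 𝓛 br v (fun m => h.orderedProd_lieAct_of
    (fun i m _ => h.orderedProd_basisOp_mon i m) u (mon_mem_polyLE (le_refl m.card))) x

-- The last variable of the sorted list acts first, so each variable is at most those already
-- present and acts by insertion.
omit h [CommGroup A] in
theorem basisOp_list_prod_zero {l : List (Fin n)} (hl : l.Pairwise (· ≤ ·)) :
    (l.map (basisOp ε br v d χ)).prod (mon k G 0) = mon k G (l : Multiset (Fin n)) := by
  induction l with
  | nil => rfl
  | cons i l ih =>
    rw [List.pairwise_cons] at hl
    rw [List.map_cons, List.prod_cons, Module.End.mul_apply, ih hl.2,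
      basisOp_of_le ε br v d χ (fun b hb => hl.1 b hb)]
    rfl

theorem exists_representation [CharZero k] :
    ∃ Φ : Enveloping (MonoidAlgebra k G) ε 𝓛 br →ₐ[k]
        Module.End (MonoidAlgebra k G) (Poly k G n),
      (∀ r, Φ (Enveloping.ofRing _ ε 𝓛 br r) = leftMul χ r) ∧
        ∀ u, Φ (Enveloping.ι _ ε 𝓛 br u) = lieAct ε br v d χ u :=
  Enveloping.exists_lift (R := MonoidAlgebra k G)
    (B := Module.End (MonoidAlgebra k G) (Poly k G n)) ε 𝓛 br (leftMul χ) (lieAct ε br v d χ)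
    h.lieAct_smul (lieAct_op_smul ε br v d χ) h.lieAct_mul_lieAct

/-- The inverse is `u ↦ Φ u 1`, with `1` the empty monomial. Intertwining (`h1`) gives `u` back and
hence surjectivity; ordered products applied to `1` rebuild their monomials (`h2`), hence
injectivity. -/
theorem orderedProd_bijective [CharZero k] : Function.Bijective (orderedProd ε 𝓛 br v) := by
  obtain ⟨Φ, hΦ1, hΦ2⟩ := h.exists_representation
  have h1 (u : Enveloping (MonoidAlgebra k G) ε 𝓛 br) (x : Poly k G n) :
      orderedProd ε 𝓛 br v (Φ u x) = u * orderedProd ε 𝓛 br v x := by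
    induction u using Enveloping.induction_on generalizing x with
    | ofRing r => rw [hΦ1, h.orderedProd_leftMul]
    | ι y => rw [hΦ2, h.orderedProd_lieAct]
    | add a b ha hb => rw [map_add, LinearMap.add_apply, map_add, ha, hb, add_mul]
    | mul a b ha hb => rw [map_mul, Module.End.mul_apply, ha, hb, mul_assoc]
  have h2 (x : Poly k G n) : Φ (orderedProd ε 𝓛 br v x) (mon k G 0) = x := by
    induction x using Finsupp.induction_linear with
    | zero => simp
    | add x y hx hy => rw [map_add, map_add, LinearMap.add_apply, hx, hy]
    | single m r =>
      -- The empty monomial has trivial weight, so left and right multiplication agree on it.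
      have hr : leftMul χ r (mon k G (0 : Multiset (Fin n))) = r • mon k G 0 := by
        induction r using MonoidAlgebra.induction_on with
        | of g => rw [leftMul_of_mon, weight_zero, MonoidHom.one_apply, one_smul]
        | add a b ha hb => rw [map_add, LinearMap.add_apply, ha, hb, add_smul]
        | smul c a ha => rw [map_smul, LinearMap.smul_apply, ha, smul_assoc]
      have hv : ⇑Φ ∘ envVar ε 𝓛 br v = basisOp ε br v d χ := by
        funext i
        exact (hΦ2 _).trans (lieAct_tmul_one ε br v d χ i)
      rw [orderedProd_single, map_mul, Module.End.mul_apply, hΦ1, hr, map_smul, map_list_prod,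
        List.map_map, hv, basisOp_list_prod_zero (Multiset.pairwise_sort _ _), Multiset.sort_eq]
      simp
  refine ⟨fun x y hxy => ?_, fun u => ⟨Φ u (mon k G 0), ?_⟩⟩
  · rw [← h2 x, ← h2 y, hxy]
  · rw [h1, orderedProd_mon, Multiset.sort_zero, List.map_nil, List.prod_nil, mul_one]

end IsHomogeneousFrame

end PBWMap

/-! ### Exponent vectors and multisets -/

section Monomials

/-- The multiset with multiplicities `p`. -/
def exponentEquiv (n : ℕ) : (Fin n → ℕ) ≃ Multiset (Fin n) :=
  Finsupp.equivFunOnFinite.symm.trans Multiset.toFinsupp.symm.toEquiv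

theorem count_exponentEquiv {n : ℕ} (p : Fin n → ℕ) (i : Fin n) :
    (exponentEquiv n p).count i = p i := by
  simp [exponentEquiv]

/-- Two sorted lists with the same multiplicities coincide; this turns the ordered product into a
product of powers. -/
theorem sort_exponentEquiv {n : ℕ} (p : Fin n → ℕ) :
    (exponentEquiv n p).sort = (List.ofFn fun i => List.replicate (p i) i).flatten := by
  refine List.Perm.eq_of_pairwise' (r := (· ≤ ·)) (Multiset.pairwise_sort _ _) ?_ ?_
  · rw [List.pairwise_flatten]
    constructor
    · intro l hl
      obtain ⟨i, rfl⟩ := (List.mem_ofFn' _ _).1 hl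
      exact List.pairwise_replicate.2 (Or.inr le_rfl)
    · rw [List.pairwise_ofFn]
      intro i j hij a ha b hb
      rw [List.eq_of_mem_replicate ha, List.eq_of_mem_replicate hb]
      exact hij.le
  · rw [← Multiset.coe_eq_coe, Multiset.sort_eq]
    ext i
    rw [count_exponentEquiv, Multiset.coe_count, List.count_flatten, List.map_ofFn,
      List.sum_ofFn]
    simp [List.count_replicate]

end Monomials

/-! ### The PBW basis, and homogeneous frames from the hypotheses -/

section PBW

variable {k : Type uk} {A : Type uA} {G : Type uG} {V : Type uV} [Field k] [CommGroup G]
  [AddCommGroup V] [Module k V] {n : ℕ} {ρ : Representation k G V}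
  {ε : A → A → kˣ} {𝓡 : A → Submodule k (MonoidAlgebra k G)}
  {𝓥 : A → Submodule k V} {𝓛 : A → Submodule k (TensorGroupAlgebra ρ)}
  {br : TensorGroupAlgebra ρ →ₗ[k] TensorGroupAlgebra ρ →ₗ[k] TensorGroupAlgebra ρ}
  {v : Module.Basis (Fin n) k V} {d : Fin n → A} {δ : G → A} {χ : Fin n → G →* k}

/-- The basis of `Poly k G n` of all products of a monomial and an element of `G`. -/
def polyBasis (k : Type uk) (G : Type uG) [Field k] [CommGroup G] (n : ℕ) :
    Module.Basis ((Fin n → ℕ) × G) k (Poly k G n) :=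
  (Finsupp.basis fun _ : Multiset (Fin n) => MonoidAlgebra.basis G k).reindex
    ((Equiv.sigmaEquivProd _ _).trans ((exponentEquiv n).symm.prodCongr (Equiv.refl G)))

theorem polyBasis_apply (p : (Fin n → ℕ) × G) :
    polyBasis k G n p = Finsupp.single (exponentEquiv n p.1) (MonoidAlgebra.of k G p.2) := by
  simp [polyBasis]

theorem orderedProd_polyBasis (p : (Fin n → ℕ) × G) :
    orderedProd ε 𝓛 br v (polyBasis k G n p) = pbwMonomial ρ ε 𝓛 br v p := by
  rw [polyBasis_apply, orderedProd_single, sort_exponentEquiv, pbwMonomial, List.map_flatten,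
    List.prod_flatten, List.map_ofFn, List.map_ofFn]
  congr 3
  funext i
  simp [envVar]

theorem IsHomogeneousFrame.hasPBWProperty [CommGroup A] [CharZero k]
    (h : IsHomogeneousFrame ε 𝓡 𝓛 br v d δ χ) : HasPBWProperty ρ ε 𝓛 br v := by
  let b := (polyBasis k G n).map (LinearEquiv.ofBijective _ h.orderedProd_bijective)
  have hb : ⇑b = pbwMonomial ρ ε 𝓛 br v := by
    funext p
    exact orderedProd_polyBasis p
  exact ⟨hb ▸ b.linearIndependent, hb ▸ b.span_eq⟩

theorem IsGrading.eq_of_mem {M : Type uL} [AddCommGroup M] [Module k M] {𝓜 : A → Submodule k M}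
    (h : IsGrading 𝓜) {a b : A} {x : M} (ha : x ∈ 𝓜 a) (hb : x ∈ 𝓜 b) (hx : x ≠ 0) : a = b := by
  by_contra hab
  exact hx (Submodule.disjoint_def.1 (h.1.pairwiseDisjoint hab) x ha hb)

/-- Write `u` as a combination of the `x p` and separate those of degree `a`. The rest lies both in
`𝓜 a` and in the sum of the other pieces, so it is zero. -/
theorem IsGrading.mem_span {M : Type uL} [AddCommGroup M] [Module k M] {𝓜 : A → Submodule k M}
    (h : IsGrading 𝓜) {ι : Type*} {x : ι → M} {deg : ι → A} (hx : ∀ p, x p ∈ 𝓜 (deg p))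
    (hspan : Submodule.span k (Set.range x) = ⊤) {a : A} {u : M} (hu : u ∈ 𝓜 a) :
    u ∈ Submodule.span k (x '' {p | deg p = a}) := by
  have hle : Submodule.span k (x '' {p | deg p = a}) ≤ 𝓜 a := by
    rw [Submodule.span_le]
    rintro _ ⟨p, rfl, rfl⟩
    exact hx p
  have htop : Submodule.span k (Set.range x) ≤
      Submodule.span k (x '' {p | deg p = a}) ⊔ ⨆ b, ⨆ _ : b ≠ a, 𝓜 b := by
    rw [Submodule.span_le]
    rintro _ ⟨p, rfl⟩
    by_cases hp : deg p = a
    · exact Submodule.mem_sup_left (Submodule.subset_span ⟨p, hp, rfl⟩)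
    · exact Submodule.mem_sup_right (Submodule.mem_iSup_of_mem (deg p)
        (Submodule.mem_iSup_of_mem hp (hx p)))
  obtain ⟨y, hy, z, hz, rfl⟩ := Submodule.mem_sup.1 (htop (hspan ▸ Submodule.mem_top : u ∈ _))
  have hz0 : z = 0 := by
    refine Submodule.disjoint_def.1 (h.1 a) z ?_ hz
    have := sub_mem hu (hle hy)
    rwa [add_sub_cancel_left] at this
  rwa [hz0, add_zero]

theorem IsPurelyPositive.positivePart_eq_top (h : IsPurelyPositive ρ ε 𝓥) :
    positivePart ε 𝓥 = ⊤ := by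
  -- The augmentation `g ↦ 1` gives a retraction `V ⊗ kG → V`, which carries `V₊ ⊗ kG` into `V₊`.
  let c : MonoidAlgebra k G →ₐ[k] k := MonoidAlgebra.lift k k G 1
  let f : TensorGroupAlgebra ρ →ₗ[k] V :=
    (TensorProduct.rid k V).toLinearMap ∘ₗ LinearMap.lTensor V c.toLinearMap
  have hf (w : V) (r : MonoidAlgebra k G) : f (TensorGroupAlgebra.tmul ρ w r) = c r • w := by
    change TensorProduct.rid k V (LinearMap.lTensor V c.toLinearMap (w ⊗ₜ[k] r)) = _
    rw [LinearMap.lTensor_tmul, TensorProduct.rid_tmul]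
    rfl
  rw [eq_top_iff]
  intro w _
  have hle : (⊤ : Submodule k (TensorGroupAlgebra ρ)) ≤ (positivePart ε 𝓥).comap f := by
    rw [← h, Submodule.span_le]
    rintro _ ⟨w, hw, r, rfl⟩
    change f _ ∈ positivePart ε 𝓥
    rw [hf]
    exact Submodule.smul_mem _ _ hw
  have : f (TensorGroupAlgebra.tmul ρ w 1) ∈ positivePart ε 𝓥 := hle Submodule.mem_top
  rwa [hf, map_one, one_smul] at this

/-- A homogeneous vector is a combination of basis vectors of its own degree, so the basis vectors
with `ε(d j, d j) = 1` already span `V₊ = V`. By independence no other basis vector exists. -/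
theorem IsPurelyPositive.ε_self_eq_one (h : IsPurelyPositive ρ ε 𝓥) (hV : IsGrading 𝓥)
    (hd : ∀ i, v i ∈ 𝓥 (d i)) (i : Fin n) : ε (d i) (d i) = 1 := by
  have hle : positivePart ε 𝓥 ≤ Submodule.span k (v '' {j | ε (d j) (d j) = 1}) := by
    rw [positivePart, Submodule.span_le]
    rintro w ⟨a, hw, ha⟩
    refine Submodule.span_mono ?_ (hV.mem_span hd v.span_eq hw)
    apply Set.image_mono
    rintro j rfl
    exact ha
  have hi : v i ∈ Submodule.span k (v '' {j | ε (d j) (d j) = 1}) :=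
    hle (h.positivePart_eq_top ▸ Submodule.mem_top)
  by_contra hne
  exact v.linearIndependent.notMem_span_image hne hi

theorem IsYetterDrinfeld.exists_isHomogeneousFrame [CommGroup A]
    (hL : IsYetterDrinfeld ρ ε 𝓡 𝓥 𝓛 br)
    (hG : ∀ (g h : G) (a b : A), MonoidAlgebra.of k G g ∈ 𝓡 a → MonoidAlgebra.of k G h ∈ 𝓡 b →
      ε a b = 1)
    (hpos : IsPurelyPositive ρ ε 𝓥) (v : Module.Basis (Fin n) k V)
    (hv : ∀ i, ∃ a : A, v i ∈ 𝓥 a) :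
    ∃ d δ χ, IsHomogeneousFrame ε 𝓡 𝓛 br v d δ χ := by
  choose d hd using hv
  choose δ hδ using hL.group_homogeneous
  have hC := hL.colorLieRing
  -- A group element is nonzero in `kG`, so its degree is unique and hence multiplicative; this
  -- makes `g ↦ ε(δ g, d i)` a character.
  have hδ_mul (g h : G) : δ (g * h) = δ g * δ h := by
    refine hC.gradedAlgebra.isGrading.eq_of_mem (hδ _) ?_
      (by simp : MonoidAlgebra.of k G (g * h) ≠ 0)
    rw [map_mul]
    exact hC.gradedAlgebra.mul_mem (hδ g) (hδ h)
  have hδ_one : δ 1 = 1 := by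
    have := hδ_mul 1 1
    rwa [mul_one, left_eq_mul] at this
  have hε_one (a : A) : ε 1 a = 1 := by
    have := hC.bicharacter.mul_left 1 1 a
    rwa [mul_one, left_eq_mul] at this
  refine ⟨d, δ, fun i =>
    { toFun := fun g => (ε (δ g) (d i) : k)
      map_one' := by rw [hδ_one, hε_one, Units.val_one]
      map_mul' := fun g h => by rw [hδ_mul, hC.bicharacter.coe_mul_left] }, ?_⟩
  exact
    { colorLieRing := hC
      δ_one := hδ_one
      ε_group := fun g h => hG g h _ _ (hδ g) (hδ h)
      ε_self := hpos.ε_self_eq_one hL.grading_V hd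
      χ_apply := fun i g => rfl
      action := fun g i => hL.action (hd i) (hδ g)
      tmul_mem := fun i g => hL.tmul_mem (hd i) (hδ g)
      mem_span := fun {a u} hu => by
        have hspan : Submodule.span k (Set.range fun p : Fin n × G =>
            TensorGroupAlgebra.tmul ρ (v p.1) (MonoidAlgebra.of k G p.2)) = ⊤ := by
          rw [eq_top_iff]
          intro x _
          induction x using tmul_induction v with
          | tmul i g => exact Submodule.subset_span ⟨(i, g), rfl⟩
          | add x y hx hy => exact add_mem (hx trivial) (hy trivial)
          | smul c x hx => exact Submodule.smul_mem _ c (hx trivial)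
          | zero => exact zero_mem _
        refine Submodule.span_mono ?_ (hC.gradedBimodule.isGrading.mem_span
          (deg := fun p : Fin n × G => d p.1 * δ p.2)
          (fun p => hL.tmul_mem (hd p.1) (hδ p.2)) hspan hu)
        rintro _ ⟨p, hp, rfl⟩
        exact ⟨p.1, p.2, hp, rfl⟩ }

end PBW

end ColorLie

end

theorem corollary7p3 {k A G V : Type*} [Field k] [CharZero k] [CommGroup A] [CommGroup G]
    [Finite G] [AddCommGroup V] [Module k V] [FiniteDimensional k V]
    (ρ : Representation k G V) (ε : A → A → kˣ)
    (𝓡 : A → Submodule k (MonoidAlgebra k G)) (𝓥 : A → Submodule k V)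
    (𝓛 : A → Submodule k (ColorLie.TensorGroupAlgebra ρ))
    (br : ColorLie.TensorGroupAlgebra ρ →ₗ[k] ColorLie.TensorGroupAlgebra ρ →ₗ[k]
      ColorLie.TensorGroupAlgebra ρ)
    (hL : ColorLie.IsYetterDrinfeld ρ ε 𝓡 𝓥 𝓛 br)
    (hG : ∀ (g h : G) (a b : A), MonoidAlgebra.of k G g ∈ 𝓡 a → MonoidAlgebra.of k G h ∈ 𝓡 b →
      ε a b = 1)
    (hpos : ColorLie.IsPurelyPositive ρ ε 𝓥)
    {n : ℕ} (v : Module.Basis (Fin n) k V) (hv : ∀ i, ∃ a : A, v i ∈ 𝓥 a) :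
    ColorLie.HasPBWProperty ρ ε 𝓛 br v := by
  obtain ⟨d, δ, χ, h⟩ := hL.exists_isHomogeneousFrame hG hpos v hv
  exact h.hasPBWProperty
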